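/- All functions are Lebesgue measurable functions on $(0,\infty)$, identified when equal a.e. For such $f$ let $f_*(\lambda)=|\{x>0:|f(x)|>\lambda\}|$ and $f^*(t)=\inf\{\lambda>0: f_*(\lambda)\le t\}$ be its distribution function and non-increasing rearrangement. For $r\in[1,\infty]$ let $\tfrac1r+\tfrac1{r'}=1$. The Lorentz space $L^{r,s}$, $r,s\in(0,\infty]$, consists of the $f$ for which $\|f\|_{r,s}<\infty$, where $$\|f\|_{r,s}=\Big(\int_0^\infty \big(t^{1/r}f^*(t)\big)^s\,\frac{dt}{t}\Big)^{1/s}\ (s<\infty),\qquad \|f\|_{r,\infty}=\sup_{t>0}t^{1/r}f^*(t)\qquad(1/\infty=0).$$ A rearrangement-invariant (r.i.) norm is a functional $\rho$ on non-negative measurable functions with values in $[0,\infty]$ such that: $\rho(f)=0$ iff $f=0$ a.e., $\rho(\lambda f)=\lambda\rho(f)$ for $\lambda\ge0$, $\rho(f+g)\le\rho(f)+\rho(g)$; $f\le g$ a.e. implies $\rho(f)\le\rho(g)$; $f_j\nearrow f$ a.e. implies $\rho(f_j)\nearrow\rho(f)$; $\rho(\chi_G)<\infty$ if $|G|<\infty$;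 for each $G$ with $|G|<\infty$ there is $C_G<\infty$ with $\int_G f\le C_G\,\rho(f)$ for all $f\ge0$; and $\rho(f)=\rho(g)$ whenever $f^*=g^*$. The space $X=\{f:\rho(|f|)<\infty\}$, with norm $\|f\|_X=\rho(|f|)$, is then called an r.i. space; a space given by a functional equivalent to an r.i. norm is also regarded as an r.i. space. $X\hookrightarrow Y$ means that $X\subset Y$ and $\|f\|_Y\le C\|f\|_X$ for some $C<\infty$ and all $f\in X$. For non-negative $a$ put $S_af(t)=\int_0^\infty a(st)f(s)\,ds$. We write $S_a\colon X\to Y$ if there is $C<\infty$ such that for every $f\in X$ the integral converges absolutely for a.e. $t>0$, $S_af\in Y$ and $\|S_af\|_Y\le C\|f\|_X$. An r.i. space $Y$ is the optimal range partner for $S_a$ and an r.i. space $X$ if $S_a\colon X\to Y$ and $Y\hookrightarrow Z$ for every r.i. space $Z$ with $S_a\colon X\to Z$. **Theorem.** Let $a\colon(0,\infty)\to[0,\infty)$ be non-increasing and not a.e. equal to $0$, and let $\eta\in[1,\infty]$. (1) Let $a\in L^1+L^\infty$ and put $a_1(t)=(a(t)-a(1))\chi_{(0,1)}(t)$ and $a_\infty(t)=\min\{a(1),a(t)\}$,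 so that $a=a_1+a_\infty$. Let $p\in[1,\infty)$ and $q\in(1,\infty]$ be such that $a_1\in L^{p',\infty}$ and $a_\infty\in L^{q',\infty}$, and let $\xi\in(p,q)$. Then $S_a\colon L^{\xi,\eta}\to L^{\xi',\eta}$, and $L^{\xi',\eta}$ is the optimal range partner for $S_a$ and $L^{\xi,\eta}$. (2) Let $p\in[1,\infty)$, $a\in L^1\cap L^{p',\infty}$, $\xi\in(1,\infty)$ and $p<\xi$. Then the same conclusion holds. (3) Let $q\in(1,\infty]$, $a\in L^\infty\cap L^{q',\infty}$, $\xi\in(1,\infty)$ and $\xi<q$. Then the same conclusion holds. -/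

import Mathlib

open MeasureTheory Set
open scoped ENNReal NNReal

noncomputable section

namespace RISpace

/-- Lebesgue measure on the half-line `(0,∞)`, carried by `ℝ`.  A function `f : ℝ → ℝ≥0∞` (or
`f : ℝ → ℝ`) which is `AEMeasurable` for `halfLine` is the same thing as a Lebesgue measurable
function on `(0,∞)`; its values on `(-∞,0]` never matter. -/
def halfLine : Measure ℝ := volume.restrict (Ioi 0)

/-- The distribution function `f_*(l) = |{x ∈ (0,∞) : f x > l}|` of a non-negative function. -/
def distribution (f : ℝ → ℝ≥0∞) (l : ℝ≥0∞) : ℝ≥0∞ := halfLine {x | l < f x}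

/-- The non-increasing rearrangement `f^*(t) = inf {l : f_*(l) ≤ t}`.
(Admitting the levels `l = 0` and `l = ∞` does not change the infimum.) -/
def rearrangement (f : ℝ → ℝ≥0∞) (t : ℝ) : ℝ≥0∞ :=
  sInf {l : ℝ≥0∞ | distribution f l ≤ ENNReal.ofReal t}

/-- Rearrangement-invariant Banach function norms: functionals on the non-negative measurable
functions on `(0,∞)` (with values in `[0,∞]`) with the usual Banach function norm axioms and
rearrangement invariance. -/
structure IsRINorm (ρ : (ℝ → ℝ≥0∞) → ℝ≥0∞) : Prop where
  eq_zero_iff : ∀ f, AEMeasurable f halfLine → (ρ f = 0 ↔ f =ᵐ[halfLine] 0)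
  smul : ∀ (c : ℝ≥0) (f), AEMeasurable f halfLine → ρ (fun s => (c : ℝ≥0∞) * f s) = c * ρ f
  add_le : ∀ f g, AEMeasurable f halfLine → AEMeasurable g halfLine →
    ρ (fun s => f s + g s) ≤ ρ f + ρ g
  mono : ∀ f g, AEMeasurable f halfLine → AEMeasurable g halfLine →
    (∀ᵐ s ∂halfLine, f s ≤ g s) → ρ f ≤ ρ g
  fatou : ∀ (u : ℕ → ℝ → ℝ≥0∞) (f), (∀ n, AEMeasurable (u n) halfLine) → AEMeasurable f halfLine →
    (∀ᵐ s ∂halfLine, Monotone (fun n => u n s) ∧ f s = ⨆ n, u n s) → ρ f = ⨆ n, ρ (u n)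
  indicator_lt_top : ∀ G : Set ℝ, MeasurableSet G → G ⊆ Ioi 0 → volume G < ∞ →
    ρ (G.indicator (fun _ => 1)) < ∞
  setLIntegral_le : ∀ G : Set ℝ, MeasurableSet G → G ⊆ Ioi 0 → volume G < ∞ →
    ∃ C : ℝ≥0, ∀ f, AEMeasurable f halfLine → ∫⁻ s in G, f s ≤ C * ρ f
  rearrangement_congr : ∀ f g, AEMeasurable f halfLine → AEMeasurable g halfLine →
    (∀ t ∈ Ioi (0 : ℝ), rearrangement f t = rearrangement g t) → ρ f = ρ g

/-- `f ∈ X(ρ)`, that is, `f` is measurable on `(0,∞)` and `ρ(|f|) < ∞`.  Members are taken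
real-valued: elements of the spaces considered here are finite almost everywhere. -/
def Mem (ρ : (ℝ → ℝ≥0∞) → ℝ≥0∞) (f : ℝ → ℝ) : Prop :=
  AEMeasurable f halfLine ∧ ρ (fun s => ‖f s‖ₑ) < ∞

/-- The functional `ρ` is equivalent to a rearrangement-invariant norm, so that the space it
governs is a rearrangement-invariant space up to equivalent renorming. -/
def IsRISpace (ρ : (ℝ → ℝ≥0∞) → ℝ≥0∞) : Prop :=
  ∃ σ : (ℝ → ℝ≥0∞) → ℝ≥0∞, IsRINorm σ ∧ ∃ C : ℝ≥0, 0 < C ∧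
    ∀ f, AEMeasurable f halfLine → ρ f ≤ C * σ f ∧ σ f ≤ C * ρ f

/-- The continuous embedding `X(ρ) ↪ X(σ)`. -/
def Embeds (ρ σ : (ℝ → ℝ≥0∞) → ℝ≥0∞) : Prop :=
  ∃ C : ℝ≥0, ∀ f : ℝ → ℝ, Mem ρ f →
    Mem σ f ∧ σ (fun s => ‖f s‖ₑ) ≤ C * ρ (fun s => ‖f s‖ₑ)

/-- The operator `S_a f (t) = ∫_0^∞ a(st) f(s) ds`. -/
def opS (a f : ℝ → ℝ) (t : ℝ) : ℝ := ∫ s, a (s * t) * f s ∂halfLine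

/-- `S_a : X(ρ) → X(σ)`: for `f ∈ X(ρ)` the integral defining `S_a f` converges absolutely for
almost every `t`, `S_a f` belongs to `X(σ)`, and `S_a` is bounded. -/
def MapsBoundedly (a : ℝ → ℝ) (ρ σ : (ℝ → ℝ≥0∞) → ℝ≥0∞) : Prop :=
  ∃ C : ℝ≥0, ∀ f : ℝ → ℝ, Mem ρ f →
    (∀ᵐ t ∂halfLine, Integrable (fun s => a (s * t) * f s) halfLine) ∧
    Mem σ (opS a f) ∧ σ (fun t => ‖opS a f t‖ₑ) ≤ C * ρ (fun s => ‖f s‖ₑ)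

/-- `X(σ)` is the optimal range partner for `S_a` and the domain space `X(ρ)`: both are
rearrangement-invariant spaces, `S_a : X(ρ) → X(σ)`, and `X(σ)` embeds into every
rearrangement-invariant space `X(τ)` with `S_a : X(ρ) → X(τ)`. -/
def IsOptimalRangePartner (a : ℝ → ℝ) (ρ σ : (ℝ → ℝ≥0∞) → ℝ≥0∞) : Prop :=
  IsRISpace ρ ∧ IsRISpace σ ∧ MapsBoundedly a ρ σ ∧
    ∀ τ : (ℝ → ℝ≥0∞) → ℝ≥0∞, IsRINorm τ → MapsBoundedly a ρ τ → Embeds σ τ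

/-- The functional governing the Lorentz space `L^{p,q}`, `p, q ∈ (0,∞]`:
`(∫_0^∞ (t^{1/p} f^*(t))^q dt/t)^{1/q}` if `q < ∞`, and `sup_{t>0} t^{1/p} f^*(t)` if `q = ∞`
(with `1/∞ = 0`). -/
def lorentz (p q : ℝ≥0∞) (f : ℝ → ℝ≥0∞) : ℝ≥0∞ :=
  if q = ∞ then
    ⨆ t ∈ Ioi (0 : ℝ), ENNReal.ofReal (t ^ p⁻¹.toReal) * rearrangement f t
  else
    (∫⁻ t in Ioi (0 : ℝ),
      (ENNReal.ofReal (t ^ p⁻¹.toReal) * rearrangement f t) ^ q.toReal * ENNReal.ofReal t⁻¹)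
        ^ q.toReal⁻¹

/-- `a ∈ L^1 + L^∞` on `(0,∞)`. -/
def MemL1AddLinfty (a : ℝ → ℝ) : Prop :=
  ∃ g h : ℝ → ℝ, MemLp g 1 halfLine ∧ MemLp h ∞ halfLine ∧ ∀ᵐ t ∂halfLine, a t = g t + h t

/-- The part `a_1 = (a - a(1)) χ_{(0,1)}`. -/
def partOne (a : ℝ → ℝ) : ℝ → ℝ := (Ioo (0 : ℝ) 1).indicator (fun t => a t - a 1)

/-- The part `a_∞ = min {a(1), a}`. -/
def partInfty (a : ℝ → ℝ) : ℝ → ℝ := fun t => min (a 1) (a t)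

end RISpace

end

namespace RISpace

/-! Everything reduces to the finiteness of the moment $A=\int_0^\infty a(u)u^{-1/\xi}\,du$.
Boundedness: by Hardy–Littlewood, $|S_af|\le S_af^*$, and this majorant is non-increasing, so it
also dominates $(S_af)^*$. In the weighted spaces $L^\eta(dt/t)$ the kernel $a(st)$ becomes a
function of the product $st$, whose sections all have integral $A$ by dilation invariance; Schur's
test gives the norm bound (`powerNorm_kernelOp_le`). Optimality: choose $\delta$ with $a(\delta)>0$,
so that $a\ge a(\delta)\chi_{(0,\delta)}$. For $g\in L^{\xi',\eta}$ the function
$f(t)=\int_0^{\delta/t}g^*$ lies in $L^{\xi,\eta}$, again by Schur, and $S_af\ge\delta a(\delta)g^*$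
(`le_kernelOp_cutoff_kernelOp_cutoff`). If $S_a\colon L^{\xi,\eta}\to Z$, rearrangement invariance
of $Z$ therefore bounds $\|g\|_Z$ by $\|g\|_{\xi',\eta}$. In each of the three cases, monotonicity
bounds $a$ by one power near $0$ and another near $\infty$, with exponents on opposite sides of
$1-1/\xi$, so $A<\infty$. -/

/-! ### Distribution functions and rearrangements. -/

lemma rearrangement_antitone (f : ℝ → ℝ≥0∞) : Antitone (rearrangement f) := fun _ _ h =>
  sInf_le_sInf fun _ hl => le_trans hl (ENNReal.ofReal_le_ofReal h)

lemma distribution_antitone (f : ℝ → ℝ≥0∞) : Antitone (distribution f) := fun _ _ h =>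
  measure_mono fun _ hx => lt_of_le_of_lt h hx

lemma measurable_rearrangement (f : ℝ → ℝ≥0∞) : Measurable (rearrangement f) :=
  (rearrangement_antitone f).measurable

/-- The infimum defining $f^*(t)$ is attained: along levels decreasing to it the superlevel sets
increase, and measure is continuous from below. This yields the Galois-type equivalence
`rearrangement_le_iff`. -/
lemma distribution_rearrangement_le (f : ℝ → ℝ≥0∞) (t : ℝ) :
    distribution f (rearrangement f t) ≤ ENNReal.ofReal t := by
  have hne : {l : ℝ≥0∞ | distribution f l ≤ ENNReal.ofReal t}.Nonempty :=
    ⟨∞, by simp [distribution]⟩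
  obtain ⟨u, hu, hlim, hmem⟩ := exists_seq_tendsto_sInf hne (OrderBot.bddBelow _)
  have hsub : {x | rearrangement f t < f x} ⊆ ⋃ n, {x | u n < f x} := by
    intro x hx
    obtain ⟨n, hn⟩ := (hlim.eventually_lt_const hx).exists
    exact mem_iUnion.2 ⟨n, hn⟩
  refine (measure_mono hsub).trans ?_
  have hmono : Monotone fun n => {x | u n < f x} := fun m n h x hx => lt_of_le_of_lt (hu h) hx
  rw [hmono.measure_iUnion]
  exact iSup_le fun n => hmem n

lemma rearrangement_le_iff {f : ℝ → ℝ≥0∞} {t : ℝ} {l : ℝ≥0∞} :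
    rearrangement f t ≤ l ↔ distribution f l ≤ ENNReal.ofReal t :=
  ⟨fun h => (distribution_antitone f h).trans (distribution_rearrangement_le f t),
    fun h => sInf_le h⟩

lemma lt_rearrangement_iff {f : ℝ → ℝ≥0∞} {t : ℝ} {l : ℝ≥0∞} :
    l < rearrangement f t ↔ ENNReal.ofReal t < distribution f l := by
  simpa using (rearrangement_le_iff (f := f) (t := t) (l := l)).not

lemma halfLine_ofReal_lt (d : ℝ≥0∞) : halfLine {s | ENNReal.ofReal s < d} = d := by
  rw [halfLine, Measure.restrict_apply (measurableSet_lt ENNReal.measurable_ofReal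
    measurable_const)]
  rcases eq_or_ne d ∞ with rfl | hd
  · simp
  · have : {s | ENNReal.ofReal s < d} ∩ Ioi 0 = Ioo 0 d.toReal := by
      ext s
      simp only [mem_inter_iff, mem_ofPred_eq, mem_Ioi, mem_Ioo]
      constructor
      · rintro ⟨h1, h2⟩
        exact ⟨h2, (ENNReal.ofReal_lt_iff_lt_toReal h2.le hd).1 h1⟩
      · rintro ⟨h1, h2⟩
        exact ⟨(ENNReal.ofReal_lt_iff_lt_toReal h1.le hd).2 h2, h1⟩
    rw [this]
    simp [hd]

lemma distribution_rearrangement (f : ℝ → ℝ≥0∞) (l : ℝ≥0∞) :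
    distribution (rearrangement f) l = distribution f l := by
  rw [distribution]
  simp only [lt_rearrangement_iff]
  exact halfLine_ofReal_lt _

lemma rearrangement_congr_distribution {f g : ℝ → ℝ≥0∞}
    (h : ∀ l, distribution f l = distribution g l) : rearrangement f = rearrangement g := by
  funext t
  simp only [rearrangement, h]

lemma rearrangement_rearrangement (f : ℝ → ℝ≥0∞) :
    rearrangement (rearrangement f) = rearrangement f :=
  rearrangement_congr_distribution (distribution_rearrangement f)

lemma distribution_mono_ae {f g : ℝ → ℝ≥0∞} (h : ∀ᵐ s ∂halfLine, f s ≤ g s) (l : ℝ≥0∞) :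
    distribution f l ≤ distribution g l :=
  measure_mono_ae (by filter_upwards [h] with s hs using fun (h' : l < f s) => h'.trans_le hs)

lemma rearrangement_mono_ae {f g : ℝ → ℝ≥0∞} (h : ∀ᵐ s ∂halfLine, f s ≤ g s) (t : ℝ) :
    rearrangement f t ≤ rearrangement g t :=
  rearrangement_le_iff.2 ((distribution_mono_ae h _).trans (distribution_rearrangement_le g t))

lemma distribution_congr_ae {f g : ℝ → ℝ≥0∞} (h : f =ᵐ[halfLine] g) (l : ℝ≥0∞) :
    distribution f l = distribution g l :=
  le_antisymm (distribution_mono_ae (h.mono fun _ hs => hs.le) l)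
    (distribution_mono_ae (h.mono fun _ hs => hs.ge) l)

/-! ### Layer cake, partial integrals of $f^*$, and the Hardy–Littlewood inequality. -/

instance : SFinite halfLine := by unfold halfLine; infer_instance

lemma ae_halfLine_pos : ∀ᵐ s ∂halfLine, 0 < s := ae_restrict_mem measurableSet_Ioi

lemma halfLine_Iio {t : ℝ} : halfLine (Iio t) = ENNReal.ofReal t := by
  rw [halfLine, Measure.restrict_apply measurableSet_Iio, inter_comm, Ioi_inter_Iio]
  simp

/-- Layer-cake formula in the first factor of a product. -/
lemma lintegral_mul_eq_lintegral_superlevel {k f : ℝ → ℝ≥0∞} (hk : Measurable k)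
    (hf : AEMeasurable f halfLine) :
    ∫⁻ s, k s * f s ∂halfLine =
      ∫⁻ u, (∫⁻ s in {s | ENNReal.ofReal u < k s}, f s ∂halfLine) ∂halfLine := by
  have hset : MeasurableSet {p : ℝ × ℝ | ENNReal.ofReal p.2 < k p.1} :=
    measurableSet_lt (ENNReal.measurable_ofReal.comp measurable_snd) (hk.comp measurable_fst)
  have hslice : ∀ u, MeasurableSet {s | ENNReal.ofReal u < k s} := fun u =>
    measurableSet_lt measurable_const hk
  have h1 : ∀ s, k s * f s =
      ∫⁻ u, {p : ℝ × ℝ | ENNReal.ofReal p.2 < k p.1}.indicator (fun p => f p.1) (s, u)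
        ∂halfLine := by
    intro s
    have : ∀ u, {p : ℝ × ℝ | ENNReal.ofReal p.2 < k p.1}.indicator (fun p => f p.1) (s, u) =
      {u | ENNReal.ofReal u < k s}.indicator (fun _ => f s) u := fun u => rfl
    simp only [this]
    rw [lintegral_indicator_const (measurableSet_lt ENNReal.measurable_ofReal measurable_const),
      halfLine_ofReal_lt, mul_comm]
  simp only [h1]
  rw [lintegral_lintegral_swap]
  · refine lintegral_congr fun u => ?_
    rw [← lintegral_indicator (hslice u)]
    rfl
  · exact (hf.comp_fst (ν := halfLine)).indicator hset

lemma lintegral_eq_lintegral_distribution {f : ℝ → ℝ≥0∞} (hf : AEMeasurable f halfLine) :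
    ∫⁻ s, f s ∂halfLine = ∫⁻ u, distribution f (ENNReal.ofReal u) ∂halfLine := by
  have h := lintegral_mul_eq_lintegral_superlevel hf.measurable_mk
    (aemeasurable_const (b := (1 : ℝ≥0∞)))
  simp only [mul_one, lintegral_const, Measure.restrict_apply_univ, one_mul] at h
  rw [lintegral_congr_ae hf.ae_eq_mk, h]
  exact lintegral_congr fun u => (distribution_congr_ae hf.ae_eq_mk _).symm

lemma distribution_tsub (f : ℝ → ℝ≥0∞) (c l : ℝ≥0∞) :
    distribution (fun s => f s - c) l = distribution f (l + c) := by
  simp only [distribution, lt_tsub_iff_right]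

/-- The excess over a level depends only on the distribution function, which $f$ and $f^*$ share. -/
lemma lintegral_rearrangement_tsub {f : ℝ → ℝ≥0∞} (hf : AEMeasurable f halfLine) (c : ℝ≥0∞) :
    ∫⁻ s, (rearrangement f s - c) ∂halfLine = ∫⁻ s, (f s - c) ∂halfLine := by
  rw [lintegral_eq_lintegral_distribution (f := fun s => f s - c) (hf.sub aemeasurable_const),
    lintegral_eq_lintegral_distribution
      (f := fun s => rearrangement f s - c)
      ((measurable_rearrangement f).aemeasurable.sub aemeasurable_const)]
  simp only [distribution_tsub, distribution_rearrangement]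

lemma lintegral_rearrangement {f : ℝ → ℝ≥0∞} (hf : AEMeasurable f halfLine) :
    ∫⁻ s, rearrangement f s ∂halfLine = ∫⁻ s, f s ∂halfLine := by
  simpa using lintegral_rearrangement_tsub hf 0

lemma setLIntegral_le_mul_add (f : ℝ → ℝ≥0∞) (c : ℝ≥0∞) (E : Set ℝ) :
    ∫⁻ s in E, f s ∂halfLine ≤ c * halfLine E + ∫⁻ s, (f s - c) ∂halfLine :=
  calc ∫⁻ s in E, f s ∂halfLine ≤ ∫⁻ s in E, (c + (f s - c)) ∂halfLine :=
        lintegral_mono fun s => le_add_tsub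
    _ = c * halfLine E + ∫⁻ s in E, (f s - c) ∂halfLine := by
        rw [lintegral_add_left measurable_const]; simp
    _ ≤ _ := by gcongr; exact Measure.restrict_le_self

lemma setLIntegral_rearrangement_le {f : ℝ → ℝ≥0∞} (hf : AEMeasurable f halfLine) (c : ℝ≥0∞)
    (T : ℝ) :
    ∫⁻ s in Iio T, rearrangement f s ∂halfLine ≤
      c * ENNReal.ofReal T + ∫⁻ s, (f s - c) ∂halfLine := by
  refine (setLIntegral_le_mul_add (rearrangement f) c (Iio T)).trans ?_
  rw [lintegral_rearrangement_tsub hf, halfLine_Iio]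

/-- Every level $c$ gives an upper bound for $\int_0^Tf^*$; the choice $c=f^*(T)$ is sharp because
$f^*$ exceeds it only on $(0,T)$. Subadditivity of $f\mapsto\int_0^Tf^*$ follows from this formula.
-/
lemma setLIntegral_rearrangement_eq {f : ℝ → ℝ≥0∞} (hf : AEMeasurable f halfLine) (T : ℝ) :
    ∫⁻ s in Iio T, rearrangement f s ∂halfLine =
      rearrangement f T * ENNReal.ofReal T + ∫⁻ s, (f s - rearrangement f T) ∂halfLine := by
  refine le_antisymm (setLIntegral_rearrangement_le hf _ T) ?_
  set c := rearrangement f T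
  have h2 : ∫⁻ s, (rearrangement f s - c) ∂halfLine =
      ∫⁻ s in Iio T, (rearrangement f s - c) ∂halfLine := by
    rw [← lintegral_indicator measurableSet_Iio]
    refine lintegral_congr fun s => ?_
    by_cases hs : s < T
    · simp [hs]
    · rw [indicator_of_notMem (by simpa using hs)]
      exact tsub_eq_zero_of_le (rearrangement_antitone f (not_lt.1 hs))
  rw [← lintegral_rearrangement_tsub hf, h2]
  have h3 : c * ENNReal.ofReal T = ∫⁻ s in Iio T, c ∂halfLine := by simp [halfLine_Iio]
  rw [h3, ← lintegral_add_left measurable_const]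
  refine setLIntegral_mono' measurableSet_Iio fun s hs => ?_
  rw [add_tsub_cancel_of_le (rearrangement_antitone f (le_of_lt hs))]

lemma setLIntegral_rearrangement_add_le {f g : ℝ → ℝ≥0∞} (hf : AEMeasurable f halfLine)
    (hg : AEMeasurable g halfLine) (T : ℝ) :
    ∫⁻ s in Iio T, rearrangement (fun s => f s + g s) s ∂halfLine ≤
      ∫⁻ s in Iio T, rearrangement f s ∂halfLine +
        ∫⁻ s in Iio T, rearrangement g s ∂halfLine := by
  rw [setLIntegral_rearrangement_eq hf, setLIntegral_rearrangement_eq hg]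
  -- The sum of the two optimal levels is an admissible level for $f+g$.
  refine (setLIntegral_rearrangement_le (hf.add hg)
    (rearrangement f T + rearrangement g T) T).trans ?_
  rw [add_mul, add_add_add_comm,
    ← lintegral_add_left' (f := fun s => f s - rearrangement f T) (hf.sub aemeasurable_const)]
  gcongr with s
  exact add_tsub_add_le_tsub_add_tsub

lemma setLIntegral_le_setLIntegral_rearrangement {f : ℝ → ℝ≥0∞} (hf : AEMeasurable f halfLine)
    (E : Set ℝ) :
    ∫⁻ s in E, f s ∂halfLine ≤
      ∫⁻ s in {s | ENNReal.ofReal s < halfLine E}, rearrangement f s ∂halfLine := by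
  rcases eq_or_ne (halfLine E) ∞ with h | h
  · simp only [h, ENNReal.ofReal_lt_top, ofPred_true, Measure.restrict_univ]
    rw [lintegral_rearrangement hf]
    exact lintegral_mono' Measure.restrict_le_self le_rfl
  · rcases eq_or_ne (halfLine E) 0 with h0 | h0
    · rw [setLIntegral_measure_zero _ _ h0]; exact zero_le
    have hT : {s | ENNReal.ofReal s < halfLine E} = Iio (halfLine E).toReal := by
      ext s
      rw [mem_ofPred_eq, mem_Iio, ← ENNReal.ofReal_lt_ofReal_iff (ENNReal.toReal_pos h0 h),
        ENNReal.ofReal_toReal h]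
    rw [hT, setLIntegral_rearrangement_eq hf, ENNReal.ofReal_toReal h]
    exact setLIntegral_le_mul_add f _ E

/-- The Hardy–Littlewood inequality against a non-increasing weight. -/
lemma lintegral_antitone_mul_le {k f : ℝ → ℝ≥0∞} (hk : Antitone k)
    (hf : AEMeasurable f halfLine) :
    ∫⁻ s, k s * f s ∂halfLine ≤ ∫⁻ s, k s * rearrangement f s ∂halfLine := by
  rw [lintegral_mul_eq_lintegral_superlevel hk.measurable hf,
    lintegral_mul_eq_lintegral_superlevel hk.measurable (measurable_rearrangement f).aemeasurable]
  refine lintegral_mono fun u => (setLIntegral_le_setLIntegral_rearrangement hf _).trans ?_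
  refine lintegral_mono_set fun s hs => ?_
  by_contra hs'
  -- A superlevel set of a non-increasing function is an initial segment, so missing $s$ forces its
  -- measure to be at most $s$.
  have hsub : {s | ENNReal.ofReal u < k s} ⊆ Iio s := by
    intro r hr
    by_contra h
    exact hs' (lt_of_lt_of_le hr (hk (not_lt.1 h)))
  exact absurd (measure_mono hsub) (by rw [halfLine_Iio]; exact not_le.2 hs)

/-- A non-increasing majorant dominates the rearrangement. -/
lemma rearrangement_le_of_le_antitone {f G : ℝ → ℝ≥0∞} (hG : Antitone G)
    (h : ∀ᵐ s ∂halfLine, f s ≤ G s) (t : ℝ) : rearrangement f t ≤ G t := by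
  refine rearrangement_le_iff.2 ((distribution_mono_ae h _).trans ?_)
  rw [← halfLine_Iio]
  refine measure_mono fun s hs => ?_
  by_contra hst
  exact absurd (hG (not_lt.1 hst)) (not_le.2 hs)

/-! ### Scaling and monotone limits of rearrangements. -/

lemma rearrangement_const_mul (c : ℝ≥0) (f : ℝ → ℝ≥0∞) (t : ℝ) :
    rearrangement (fun s => (c : ℝ≥0∞) * f s) t = c * rearrangement f t := by
  rcases eq_or_ne c 0 with rfl | hc
  · simp only [ENNReal.coe_zero, zero_mul]
    exact le_antisymm (rearrangement_le_iff.2 (by simp [distribution])) zero_le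
  have hc0 : (c : ℝ≥0∞) ≠ 0 := by simpa using hc
  refine eq_of_forall_ge_iff fun l => ?_
  rw [mul_comm, ← ENNReal.le_div_iff_mul_le (Or.inl hc0) (Or.inl ENNReal.coe_ne_top),
    rearrangement_le_iff, rearrangement_le_iff, distribution, distribution]
  simp only [ENNReal.div_lt_iff (Or.inl hc0) (Or.inl ENNReal.coe_ne_top), mul_comm]

lemma distribution_iSup {u : ℕ → ℝ → ℝ≥0∞} {f : ℝ → ℝ≥0∞}
    (h : ∀ᵐ s ∂halfLine, Monotone (fun n => u n s) ∧ f s = ⨆ n, u n s) (l : ℝ≥0∞) :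
    distribution f l = ⨆ n, distribution (u n) l := by
  refine le_antisymm ?_ (iSup_le fun n => distribution_mono_ae
    (h.mono fun s hs => hs.2 ▸ le_iSup (fun n => u n s) n) l)
  -- The running maxima are increasing everywhere, whereas the $u_n$ are so only almost everywhere.
  have h1 : distribution f l ≤ halfLine (⋃ n, {x | l < ⨆ m ≤ n, u m x}) := by
    refine measure_mono_ae ?_
    filter_upwards [h] with s hs (hl : l < f s)
    rw [hs.2, lt_iSup_iff] at hl
    obtain ⟨n, hn⟩ := hl
    exact mem_iUnion.2 ⟨n, hn.trans_le (le_iSup₂ (f := fun m (_ : m ≤ n) => u m s) n le_rfl)⟩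
  refine h1.trans ?_
  have hmono : Monotone fun n => {x | l < ⨆ m ≤ n, u m x} := fun m n hmn x (hx : l < _) =>
    hx.trans_le (biSup_mono fun i hi => hi.trans hmn)
  rw [hmono.measure_iUnion]
  refine iSup_mono fun n => distribution_mono_ae ?_ l
  filter_upwards [h] with s hs
  exact iSup₂_le fun m hm => hs.1 hm

lemma rearrangement_iSup {u : ℕ → ℝ → ℝ≥0∞} {f : ℝ → ℝ≥0∞}
    (h : ∀ᵐ s ∂halfLine, Monotone (fun n => u n s) ∧ f s = ⨆ n, u n s) (t : ℝ) :
    rearrangement f t = ⨆ n, rearrangement (u n) t := by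
  refine eq_of_forall_ge_iff fun l => ?_
  simp only [rearrangement_le_iff, distribution_iSup h, iSup_le_iff]

/-! ### Schur's test. -/

/-- Jensen's inequality for the measure $K\,d\mu$; its total mass is not normalised, hence the extra
factor. -/
lemma lintegral_mul_rpow_le {μ : Measure ℝ} {K φ : ℝ → ℝ≥0∞} (hK : Measurable K)
    (hφ : Measurable φ) {r : ℝ} (hr : 1 ≤ r) :
    (∫⁻ s, K s * φ s ∂μ) ^ r ≤ (∫⁻ s, K s ∂μ) ^ (r - 1) * ∫⁻ s, K s * φ s ^ r ∂μ := by
  have hr0 : 0 < r := by linarith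
  have h := eLpNorm'_le_eLpNorm'_mul_rpow_measure_univ (μ := μ.withDensity K) (f := φ)
    (p := 1) (q := r) one_pos hr hφ.aestronglyMeasurable
  simp only [eLpNorm', enorm_eq_self, ENNReal.rpow_one, div_one, withDensity_apply _
    MeasurableSet.univ, Measure.restrict_univ] at h
  rw [lintegral_withDensity_eq_lintegral_mul _ hK hφ,
    lintegral_withDensity_eq_lintegral_mul _ hK (hφ.pow_const r)] at h
  simp only [Pi.mul_apply] at h
  calc (∫⁻ s, K s * φ s ∂μ) ^ r
      ≤ ((∫⁻ s, K s * φ s ^ r ∂μ) ^ (1 / r) * (∫⁻ s, K s ∂μ) ^ (1 - 1 / r)) ^ r := by gcongr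
    _ = _ := by
      rw [ENNReal.mul_rpow_of_nonneg _ _ hr0.le, ← ENNReal.rpow_mul, ← ENNReal.rpow_mul,
        one_div_mul_cancel hr0.ne', ENNReal.rpow_one, mul_comm]
      congr 2
      field_simp

/-- Schur's test with constant weights, for all exponents in `[1,∞]`. -/
lemma eLpNorm_lintegral_mul_le {μ : Measure ℝ} [SFinite μ] {K : ℝ → ℝ → ℝ≥0∞}
    (hK : Measurable (Function.uncurry K)) {A : ℝ≥0∞}
    (h1 : ∀ᵐ t ∂μ, ∫⁻ s, K t s ∂μ ≤ A) (h2 : ∀ᵐ s ∂μ, ∫⁻ t, K t s ∂μ ≤ A)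
    {φ : ℝ → ℝ≥0∞} (hφ : Measurable φ) {η : ℝ≥0∞} (hη : 1 ≤ η) :
    eLpNorm (fun t => ∫⁻ s, K t s * φ s ∂μ) η μ ≤ A * eLpNorm φ η μ := by
  have hKt : ∀ t, Measurable (K t) := fun t => hK.comp measurable_prodMk_left
  rcases eq_or_ne η ∞ with rfl | hη'
  · rw [eLpNorm_exponent_top, eLpNorm_exponent_top]
    refine eLpNormEssSup_le_of_ae_enorm_bound ?_
    filter_upwards [h1] with t ht
    rw [enorm_eq_self]
    calc ∫⁻ s, K t s * φ s ∂μ ≤ ∫⁻ s, K t s * eLpNormEssSup φ μ ∂μ := by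
          refine lintegral_mono_ae ?_
          filter_upwards [enorm_ae_le_eLpNormEssSup φ μ] with s hs
          gcongr
          simpa using hs
      _ = (∫⁻ s, K t s ∂μ) * eLpNormEssSup φ μ := lintegral_mul_const _ (hKt t)
      _ ≤ _ := by gcongr
  · have hη0 : η ≠ 0 := (zero_lt_one.trans_le hη).ne'
    have hr : 1 ≤ η.toReal := by
      simpa using (ENNReal.toReal_le_toReal ENNReal.one_ne_top hη').2 hη
    have hr0 : 0 < η.toReal := by linarith
    rw [eLpNorm_eq_lintegral_rpow_enorm_toReal hη0 hη',
      eLpNorm_eq_lintegral_rpow_enorm_toReal hη0 hη']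
    simp only [enorm_eq_self]
    set r := η.toReal
    calc (∫⁻ t, (∫⁻ s, K t s * φ s ∂μ) ^ r ∂μ) ^ (1 / r)
        ≤ (A ^ r * ∫⁻ s, φ s ^ r ∂μ) ^ (1 / r) := by
          gcongr
          calc ∫⁻ t, (∫⁻ s, K t s * φ s ∂μ) ^ r ∂μ
              ≤ ∫⁻ t, A ^ (r - 1) * ∫⁻ s, K t s * φ s ^ r ∂μ ∂μ := by
                refine lintegral_mono_ae ?_
                filter_upwards [h1] with t ht
                refine (lintegral_mul_rpow_le (hKt t) hφ hr).trans ?_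
                gcongr
            _ = A ^ (r - 1) * ∫⁻ t, ∫⁻ s, K t s * φ s ^ r ∂μ ∂μ :=
                lintegral_const_mul _ (Measurable.lintegral_prod_right'
                  (f := fun p : ℝ × ℝ => K p.1 p.2 * φ p.2 ^ r)
                  (hK.mul ((hφ.comp measurable_snd).pow_const r)))
            _ = A ^ (r - 1) * ∫⁻ s, (∫⁻ t, K t s ∂μ) * φ s ^ r ∂μ := by
                rw [lintegral_lintegral_swap
                  (hK.mul ((hφ.comp measurable_snd).pow_const r)).aemeasurable]
                congr 1
                refine lintegral_congr fun s => lintegral_mul_const _ ?_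
                exact hK.comp measurable_prodMk_right
            _ ≤ A ^ (r - 1) * ∫⁻ s, A * φ s ^ r ∂μ := by
                gcongr 1
                refine lintegral_mono_ae ?_
                filter_upwards [h2] with s hs
                gcongr
            _ = A ^ r * ∫⁻ s, φ s ^ r ∂μ := by
                rw [lintegral_const_mul _ (hφ.pow_const r), ← mul_assoc]
                congr 1
                conv_lhs => rw [← ENNReal.rpow_one A, ← ENNReal.rpow_mul]
                rw [one_mul, ← ENNReal.rpow_add_of_nonneg _ _ (by linarith) zero_le_one,
                  sub_add_cancel]
      _ = _ := by
          rw [ENNReal.mul_rpow_of_nonneg _ _ (by positivity), ← ENNReal.rpow_mul,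
            mul_one_div_cancel hr0.ne', ENNReal.rpow_one]

/-! ### Power-weighted $L^\eta(dt/t)$ norms and kernels depending on $st$. -/

/-- The measure `dt/t` on `(0,∞)`. -/
noncomputable def invMeasure : Measure ℝ := halfLine.withDensity fun t => ENNReal.ofReal t⁻¹

instance : SFinite invMeasure := by unfold invMeasure; infer_instance

lemma lintegral_invMeasure (h : ℝ → ℝ≥0∞) :
    ∫⁻ t, h t ∂invMeasure = ∫⁻ t, ENNReal.ofReal t⁻¹ * h t ∂halfLine :=
  lintegral_withDensity_eq_lintegral_mul_non_measurable _
    (ENNReal.measurable_ofReal.comp measurable_inv) (by simp) h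

lemma ae_invMeasure_iff {P : ℝ → Prop} : (∀ᵐ t ∂invMeasure, P t) ↔ ∀ᵐ t ∂halfLine, P t := by
  constructor
  · refine fun h => (withDensity_absolutelyContinuous' (μ := halfLine)
      (f := fun t : ℝ => ENNReal.ofReal t⁻¹)
      (ENNReal.measurable_ofReal.comp measurable_inv).aemeasurable ?_).ae_le h
    filter_upwards [ae_halfLine_pos] with t ht
    simpa using ht
  · exact fun h => (withDensity_absolutelyContinuous halfLine _).ae_le h

/-- The weighted norm `‖t^θ φ(t)‖` in `L^η(dt/t)`. -/
noncomputable def powerNorm (θ : ℝ) (η : ℝ≥0∞) (φ : ℝ → ℝ≥0∞) : ℝ≥0∞ :=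
  eLpNorm (fun t => ENNReal.ofReal (t ^ θ) * φ t) η invMeasure

/-- The operator `φ ↦ ∫_0^∞ k(st) φ(s) ds` on non-negative functions. -/
noncomputable def kernelOp (k φ : ℝ → ℝ≥0∞) (t : ℝ) : ℝ≥0∞ := ∫⁻ s, k (s * t) * φ s ∂halfLine

lemma kernelOp_antitone {k : ℝ → ℝ≥0∞} (hk : Antitone k) (φ : ℝ → ℝ≥0∞) :
    Antitone (kernelOp k φ) := by
  intro t t' h
  refine lintegral_mono_ae ?_
  filter_upwards [ae_halfLine_pos] with s hs
  gcongr
  exact hk (by gcongr)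

lemma lintegral_halfLine_comp_mul_right {t : ℝ} (ht : 0 < t) {H : ℝ → ℝ≥0∞}
    (hH : Measurable H) :
    ∫⁻ s, ENNReal.ofReal t * H (s * t) ∂halfLine = ∫⁻ u, H u ∂halfLine := by
  rw [halfLine, ← lintegral_indicator measurableSet_Ioi, ← lintegral_indicator measurableSet_Ioi]
  conv_rhs => rw [← Real.smul_map_volume_mul_right ht.ne', abs_of_pos ht]
  rw [lintegral_smul_measure, lintegral_map (hH.indicator measurableSet_Ioi)
    (measurable_mul_const t), smul_eq_mul, ← lintegral_const_mul]
  · refine lintegral_congr fun s => ?_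
    by_cases hs : 0 < s
    · simp [indicator, hs, mul_pos hs ht]
    · have : ¬ 0 < s * t := fun h => hs (pos_of_mul_pos_left h ht.le)
      simp [indicator, hs, this]
  · exact (hH.indicator measurableSet_Ioi).comp (measurable_mul_const t)

/-- Boundedness of `kernelOp k` between weighted `L^η(dt/t)` spaces. -/
lemma powerNorm_kernelOp_le {k : ℝ → ℝ≥0∞} (hk : Antitone k) {φ : ℝ → ℝ≥0∞}
    (hφ : Measurable φ) (θ : ℝ) {η : ℝ≥0∞} (hη : 1 ≤ η) :
    powerNorm (1 - θ) η (kernelOp k φ) ≤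
      (∫⁻ u, k u * ENNReal.ofReal (u ^ (-θ)) ∂halfLine) * powerNorm θ η φ := by
  set A := ∫⁻ u, k u * ENNReal.ofReal (u ^ (-θ)) ∂halfLine
  have hkm := hk.measurable
  have hpow : ∀ x : ℝ, Measurable fun s : ℝ => ENNReal.ofReal (s ^ x) := fun x => by fun_prop
  -- Moving the weights $t^{1-\theta}$ and $s^\theta$, and the density of $ds/s$, into the kernel
  -- leaves a function of $st$ alone. It is symmetric, so one computation serves both hypotheses of
  -- Schur's test.
  let K : ℝ → ℝ → ℝ≥0∞ := fun t s => k (s * t) * ENNReal.ofReal ((s * t) ^ (1 - θ))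
  have hK : Measurable (Function.uncurry K) := by
    have hm : Measurable fun p : ℝ × ℝ => p.2 * p.1 := by fun_prop
    exact (hkm.comp hm).mul ((hpow _).comp hm)
  have hint : ∀ t, 0 < t → ∫⁻ s, K t s ∂invMeasure = A := by
    intro t ht
    change _ = ∫⁻ u, k u * ENNReal.ofReal (u ^ (-θ)) ∂halfLine
    rw [lintegral_invMeasure, ← lintegral_halfLine_comp_mul_right ht
      (H := fun u => k u * ENNReal.ofReal (u ^ (-θ))) (hkm.mul (hpow (-θ)))]
    refine lintegral_congr_ae ?_
    filter_upwards [ae_halfLine_pos] with s hs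
    have : s⁻¹ * (s * t) ^ (1 - θ) = t * (s * t) ^ (-θ) := by
      rw [sub_eq_add_neg, Real.rpow_add (mul_pos hs ht), Real.rpow_one]
      field_simp
    calc ENNReal.ofReal s⁻¹ * (k (s * t) * ENNReal.ofReal ((s * t) ^ (1 - θ)))
        = k (s * t) * ENNReal.ofReal (s⁻¹ * (s * t) ^ (1 - θ)) := by
          rw [ENNReal.ofReal_mul (by positivity)]; ring
      _ = ENNReal.ofReal t * (k (s * t) * ENNReal.ofReal ((s * t) ^ (-θ))) := by
          rw [this, ENNReal.ofReal_mul ht.le]; ring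
  have hsymm : ∀ s t, K t s = K s t := fun s t => by simp only [K, mul_comm s t]
  have h1 : ∀ᵐ t ∂invMeasure, ∫⁻ s, K t s ∂invMeasure ≤ A :=
    ae_invMeasure_iff.2 (ae_halfLine_pos.mono fun t ht => (hint t ht).le)
  have h2 : ∀ᵐ s ∂invMeasure, ∫⁻ t, K t s ∂invMeasure ≤ A := by
    simpa only [hsymm] using h1
  refine le_trans (le_of_eq ?_) (eLpNorm_lintegral_mul_le hK h1 h2 ((hpow θ).mul hφ) hη)
  refine eLpNorm_congr_ae (ae_invMeasure_iff.2 ?_)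
  filter_upwards [ae_halfLine_pos] with t ht
  rw [lintegral_invMeasure, kernelOp, ← lintegral_const_mul']
  · refine lintegral_congr_ae ?_
    filter_upwards [ae_halfLine_pos] with s hs
    have : t ^ (1 - θ) = s⁻¹ * ((s * t) ^ (1 - θ) * s ^ θ) := by
      rw [Real.mul_rpow hs.le ht.le, mul_right_comm, ← Real.rpow_add hs, sub_add_cancel,
        Real.rpow_one]
      field_simp
    rw [this, ENNReal.ofReal_mul (by positivity), ENNReal.ofReal_mul (by positivity)]
    simp only [K, Pi.mul_apply]
    ring
  · exact ENNReal.ofReal_ne_top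

lemma powerNorm_mono {θ : ℝ} {η : ℝ≥0∞} {φ ψ : ℝ → ℝ≥0∞}
    (h : ∀ᵐ s ∂halfLine, φ s ≤ ψ s) : powerNorm θ η φ ≤ powerNorm θ η ψ := by
  refine eLpNorm_mono_enorm_ae (ae_invMeasure_iff.2 ?_)
  filter_upwards [h] with s hs
  simp only [enorm_eq_self]
  gcongr

lemma powerNorm_add_le {θ : ℝ} {η : ℝ≥0∞} (hη : 1 ≤ η) {φ ψ : ℝ → ℝ≥0∞} (hφ : Measurable φ)
    (hψ : Measurable ψ) :
    powerNorm θ η (fun s => φ s + ψ s) ≤ powerNorm θ η φ + powerNorm θ η ψ := by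
  have hpow : Measurable fun s : ℝ => ENNReal.ofReal (s ^ θ) := by fun_prop
  refine le_trans (le_of_eq ?_) (eLpNorm_add_le (hpow.mul hφ).aestronglyMeasurable
    (hpow.mul hψ).aestronglyMeasurable hη)
  refine congrArg (fun g => eLpNorm g η invMeasure) (funext fun s => ?_)
  simp [mul_add]

lemma powerNorm_top_le_iff {θ : ℝ} {φ : ℝ → ℝ≥0∞} {M : ℝ≥0∞} :
    powerNorm θ ∞ φ ≤ M ↔ ∀ᵐ s ∂halfLine, ENNReal.ofReal (s ^ θ) * φ s ≤ M := by
  rw [powerNorm, eLpNorm_exponent_top, ← ae_invMeasure_iff]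
  constructor
  · intro h
    filter_upwards [enorm_ae_le_eLpNormEssSup (fun t => ENNReal.ofReal (t ^ θ) * φ t) invMeasure]
      with s hs using hs.trans h
  · exact fun h => eLpNormEssSup_le_of_ae_enorm_bound h

lemma powerNorm_eq_lintegral {θ : ℝ} {η : ℝ≥0∞} (h0 : η ≠ 0) (ht : η ≠ ∞) (φ : ℝ → ℝ≥0∞) :
    powerNorm θ η φ = (∫⁻ t, (ENNReal.ofReal (t ^ θ) * φ t) ^ η.toReal * ENNReal.ofReal t⁻¹
      ∂halfLine) ^ η.toReal⁻¹ := by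
  rw [powerNorm, eLpNorm_eq_lintegral_rpow_enorm_toReal h0 ht, lintegral_invMeasure, one_div]
  simp only [enorm_eq_self, mul_comm]

lemma powerNorm_const_mul {θ : ℝ} {η : ℝ≥0∞} {c : ℝ≥0∞} (hc : c ≠ ∞) (hη : 1 ≤ η)
    (φ : ℝ → ℝ≥0∞) : powerNorm θ η (fun s => c * φ s) = c * powerNorm θ η φ := by
  rcases eq_or_ne c 0 with rfl | hc0
  · simp only [zero_mul, powerNorm, mul_zero]
    exact eLpNorm_zero'
  rcases eq_or_ne η ∞ with rfl | ht
  · refine eq_of_forall_ge_iff fun M => ?_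
    rw [powerNorm_top_le_iff, mul_comm c, ← ENNReal.le_div_iff_mul_le (Or.inl hc0) (Or.inl hc),
      powerNorm_top_le_iff]
    simp only [ENNReal.le_div_iff_mul_le (Or.inl hc0) (Or.inl hc), mul_assoc, mul_comm c]
  · have h0 : η ≠ 0 := (zero_lt_one.trans_le hη).ne'
    have hr : 0 < η.toReal := ENNReal.toReal_pos h0 ht
    rw [powerNorm_eq_lintegral h0 ht, powerNorm_eq_lintegral h0 ht]
    have : ∀ t, (ENNReal.ofReal (t ^ θ) * (c * φ t)) ^ η.toReal * ENNReal.ofReal t⁻¹ =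
        c ^ η.toReal * ((ENNReal.ofReal (t ^ θ) * φ t) ^ η.toReal * ENNReal.ofReal t⁻¹) := by
      intro t
      rw [mul_left_comm, ENNReal.mul_rpow_of_nonneg _ _ hr.le, mul_assoc]
    simp only [this]
    rw [lintegral_const_mul' _ _ (ENNReal.rpow_ne_top_of_nonneg hr.le hc),
      ENNReal.mul_rpow_of_nonneg _ _ (by positivity), ← ENNReal.rpow_mul,
      mul_inv_cancel₀ hr.ne', ENNReal.rpow_one]

lemma powerNorm_iSup {θ : ℝ} {η : ℝ≥0∞} (hη : 1 ≤ η) {u : ℕ → ℝ → ℝ≥0∞}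
    (hu : ∀ n, Measurable (u n)) (hmono : Monotone u) :
    powerNorm θ η (fun s => ⨆ n, u n s) = ⨆ n, powerNorm θ η (u n) := by
  rcases eq_or_ne η ∞ with rfl | ht
  · refine eq_of_forall_ge_iff fun M => ?_
    simp only [powerNorm_top_le_iff, iSup_le_iff, ENNReal.mul_iSup, ae_all_iff]
  · have h0 : η ≠ 0 := (zero_lt_one.trans_le hη).ne'
    have hr : 0 < η.toReal := ENNReal.toReal_pos h0 ht
    simp only [powerNorm_eq_lintegral h0 ht]
    have hpow : Measurable fun s : ℝ => ENNReal.ofReal (s ^ θ) := by fun_prop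
    have key : ∀ (y : ℝ) (_ : 0 < y) (x : ℕ → ℝ≥0∞), (⨆ n, x n) ^ y = ⨆ n, x n ^ y :=
      fun y hy x => (ENNReal.orderIsoRpow y hy).map_iSup x
    rw [← key _ (inv_pos.2 hr), ← lintegral_iSup]
    · simp only [ENNReal.mul_iSup, key _ hr, ENNReal.iSup_mul]
    · exact fun n => ((hpow.mul (hu n)).pow_const _).mul
        (ENNReal.measurable_ofReal.comp measurable_inv)
    · intro m n hmn s
      dsimp only
      gcongr
      exact hmono hmn s

lemma powerNorm_eq_zero_iff {θ : ℝ} {η : ℝ≥0∞} (hη : 1 ≤ η) {φ : ℝ → ℝ≥0∞} (hφ : Measurable φ) :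
    powerNorm θ η φ = 0 ↔ φ =ᵐ[halfLine] 0 := by
  have hpow : Measurable fun s : ℝ => ENNReal.ofReal (s ^ θ) := by fun_prop
  have hm : Measurable fun s => ENNReal.ofReal (s ^ θ) * φ s := hpow.mul hφ
  rw [powerNorm, eLpNorm_eq_zero_iff hm.aestronglyMeasurable
    (zero_lt_one.trans_le hη).ne', Filter.EventuallyEq, ae_invMeasure_iff]
  refine Filter.eventually_congr ?_
  filter_upwards [ae_halfLine_pos] with s hs
  simp [not_le.2 (Real.rpow_pos_of_pos hs θ)]

lemma ae_lt_top_of_powerNorm_lt_top {θ : ℝ} {η : ℝ≥0∞} (hη : 1 ≤ η) {φ : ℝ → ℝ≥0∞}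
    (hφ : Measurable φ) (h : powerNorm θ η φ < ∞) : ∀ᵐ s ∂halfLine, φ s < ∞ := by
  have hpow : Measurable fun s : ℝ => ENNReal.ofReal (s ^ θ) := by fun_prop
  have h' : ∀ᵐ s ∂halfLine, ENNReal.ofReal (s ^ θ) * φ s < ∞ := by
    rcases eq_or_ne η ∞ with rfl | ht
    · exact (powerNorm_top_le_iff.1 le_rfl).mono fun s hs => hs.trans_lt h
    · have h0 : η ≠ 0 := (zero_lt_one.trans_le hη).ne'
      have hr : 0 < η.toReal := ENNReal.toReal_pos h0 ht
      have h2 := lintegral_rpow_enorm_lt_top_of_eLpNorm_lt_top h0 ht h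
      have h3 := ae_lt_top ((hpow.mul hφ).enorm.pow_const η.toReal) h2.ne
      refine (ae_invMeasure_iff.1 h3).mono fun s hs => ?_
      simpa [ENNReal.rpow_lt_top_iff_of_pos hr] using hs
  filter_upwards [h', ae_halfLine_pos] with s hs hs0
  refine lt_of_not_ge fun hh => ?_
  rw [top_le_iff.1 hh, ENNReal.mul_top (by simpa using Real.rpow_pos_of_pos hs0 θ)] at hs
  exact lt_irrefl _ hs

/-! ### The Lorentz functional as a weighted norm of $f^*$. -/

lemma powerNorm_le_lorentz {p η : ℝ≥0∞} (hη : 1 ≤ η) (f : ℝ → ℝ≥0∞) :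
    powerNorm p⁻¹.toReal η (rearrangement f) ≤ lorentz p η f := by
  rcases eq_or_ne η ∞ with rfl | ht
  · rw [lorentz, if_pos rfl, powerNorm_top_le_iff]
    filter_upwards [ae_halfLine_pos] with s hs
    exact le_iSup₂ (f := fun t (_ : t ∈ Ioi (0 : ℝ)) =>
      ENNReal.ofReal (t ^ p⁻¹.toReal) * rearrangement f t) s hs
  · rw [lorentz, if_neg ht, powerNorm_eq_lintegral (zero_lt_one.trans_le hη).ne' ht]
    rfl

/-- The factor $2$ matters only for $\eta=\infty$, where a supremum is compared with an essential
supremum: a good point $s\in(t/2,t)$ has $f^*(s)\ge f^*(t)$ and loses at most $2^{1/p}\le2$ in the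
weight. -/
lemma lorentz_le_powerNorm {p η : ℝ≥0∞} (hη : 1 ≤ η) (hp : 1 ≤ p) (f : ℝ → ℝ≥0∞) :
    lorentz p η f ≤ 2 * powerNorm p⁻¹.toReal η (rearrangement f) := by
  rcases eq_or_ne η ∞ with rfl | ht
  · rw [lorentz, if_pos rfl]
    refine iSup₂_le fun t (ht : 0 < t) => ?_
    have hae := powerNorm_top_le_iff.1 (le_refl (powerNorm p⁻¹.toReal ∞ (rearrangement f)))
    rw [halfLine, ae_restrict_iff' measurableSet_Ioi] at hae
    have hpos : volume (Ioo (t / 2) t) ≠ 0 := by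
      rw [Real.volume_Ioo]; simp; linarith
    obtain ⟨s, hs, hs'⟩ := Measure.exists_mem_of_measure_ne_zero_of_ae hpos
      (ae_restrict_of_ae (s := Ioo (t / 2) t) hae)
    have hs0 : 0 < s := by linarith [hs.1]
    have hθ : p⁻¹.toReal ≤ 1 := by
      have := ENNReal.toReal_mono ENNReal.one_ne_top (ENNReal.inv_le_one.2 hp)
      simpa using this
    have hle : t ^ p⁻¹.toReal ≤ 2 * s ^ p⁻¹.toReal :=
      calc t ^ p⁻¹.toReal ≤ (2 * s) ^ p⁻¹.toReal := by
            gcongr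
            linarith [hs.1]
        _ = 2 ^ p⁻¹.toReal * s ^ p⁻¹.toReal := Real.mul_rpow (by norm_num) hs0.le
        _ ≤ 2 ^ (1 : ℝ) * s ^ p⁻¹.toReal := by
            gcongr
            norm_num
        _ = _ := by rw [Real.rpow_one]
    calc ENNReal.ofReal (t ^ p⁻¹.toReal) * rearrangement f t
        ≤ ENNReal.ofReal (2 * s ^ p⁻¹.toReal) * rearrangement f s := by
          gcongr
          exact rearrangement_antitone f hs.2.le
      _ = 2 * (ENNReal.ofReal (s ^ p⁻¹.toReal) * rearrangement f s) := by
          rw [ENNReal.ofReal_mul (by norm_num), mul_assoc]; simp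
      _ ≤ _ := by
          gcongr
          exact hs' hs0
  · rw [lorentz, if_neg ht, powerNorm_eq_lintegral (zero_lt_one.trans_le hη).ne' ht]
    exact le_mul_of_one_le_left' one_le_two

/-! ### Cutoff kernels and the r.i. norm equivalent to the Lorentz functional. -/

/-- The kernel `χ_{(-∞,δ)}`. -/
noncomputable def cutoff (δ : ℝ) : ℝ → ℝ≥0∞ := (Iio δ).indicator 1

lemma cutoff_antitone (δ : ℝ) : Antitone (cutoff δ) := by
  intro s t h
  by_cases ht : t < δ
  · simp [cutoff, ht, h.trans_lt ht]
  · simp [cutoff, ht]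

lemma kernelOp_cutoff {δ t : ℝ} (ht : 0 < t) (φ : ℝ → ℝ≥0∞) :
    kernelOp (cutoff δ) φ t = ∫⁻ s in Iio (δ / t), φ s ∂halfLine := by
  rw [kernelOp, ← lintegral_indicator measurableSet_Iio]
  refine lintegral_congr fun s => ?_
  simp only [cutoff, indicator, mem_Iio, lt_div_iff₀ ht]
  split_ifs <;> simp

lemma lintegral_cutoff_mul_rpow_lt_top {x : ℝ} (hx : -1 < x) (T : ℝ) :
    ∫⁻ s, cutoff T s * ENNReal.ofReal (s ^ x) ∂halfLine < ∞ := by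
  have h0 : ∀ s, cutoff T s * ENNReal.ofReal (s ^ x) =
      (Iio T).indicator (fun s => ENNReal.ofReal (s ^ x)) s := by
    intro s; simp only [cutoff, indicator]; split_ifs <;> simp
  simp only [h0]
  rw [lintegral_indicator measurableSet_Iio, halfLine, Measure.restrict_restrict measurableSet_Iio,
    inter_comm, Ioi_inter_Iio]
  rcases le_or_gt T 0 with hT | hT
  · simp [Ioo_eq_empty (not_lt.2 hT)]
  have h := (intervalIntegral.integrableOn_Ioo_rpow_iff hT).2 hx
  refine lt_of_le_of_lt (lintegral_mono fun s => ?_) h.hasFiniteIntegral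
  exact Real.ofReal_le_enorm _

lemma lintegral_cutoff_mul_rpow_pos {x T : ℝ} (hT : 0 < T) :
    0 < ∫⁻ s, cutoff T s * ENNReal.ofReal (s ^ x) ∂halfLine := by
  have hm : Measurable fun s => cutoff T s * ENNReal.ofReal (s ^ x) :=
    (cutoff_antitone T).measurable.mul (by fun_prop)
  rw [lintegral_pos_iff_support hm]
  refine lt_of_lt_of_le ?_ (measure_mono (s := Ioo 0 T) ?_)
  · rw [halfLine, Measure.restrict_apply measurableSet_Ioo,
      inter_eq_left.2 Ioo_subset_Ioi_self]
    simpa using hT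
  · rintro s ⟨h1, h2⟩
    simp [cutoff, h2, Real.rpow_pos_of_pos h1]

lemma powerNorm_cutoff_lt_top {θ : ℝ} (hθ : 0 < θ) {η : ℝ≥0∞} (hη : 1 ≤ η) (T : ℝ) :
    powerNorm θ η (cutoff T) < ∞ := by
  rcases eq_or_ne η ∞ with rfl | ht
  · refine lt_of_le_of_lt (powerNorm_top_le_iff.2 ?_) (ENNReal.ofReal_lt_top (r := T ^ θ))
    filter_upwards [ae_halfLine_pos] with s hs
    by_cases h : s < T
    · simp only [cutoff, mem_Iio, h, indicator_of_mem, Pi.one_apply, mul_one]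
      gcongr
    · simp [cutoff, h]
  · have h0 : η ≠ 0 := (zero_lt_one.trans_le hη).ne'
    have hr : 0 < η.toReal := ENNReal.toReal_pos h0 ht
    rw [powerNorm_eq_lintegral h0 ht]
    refine ENNReal.rpow_lt_top_of_nonneg (by positivity) (ne_of_lt ?_)
    refine lt_of_le_of_lt (le_of_eq ?_)
      (lintegral_cutoff_mul_rpow_lt_top (x := θ * η.toReal - 1) (by nlinarith [mul_pos hθ hr]) T)
    refine lintegral_congr_ae ?_
    filter_upwards [ae_halfLine_pos] with s hs
    by_cases h : s < T
    · simp only [cutoff, mem_Iio, h, indicator_of_mem, Pi.one_apply, mul_one, one_mul]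
      rw [ENNReal.ofReal_rpow_of_pos (by positivity), ← ENNReal.ofReal_mul (by positivity),
        ← Real.rpow_mul hs.le, Real.rpow_sub_one hs.ne', div_eq_mul_inv]
    · simp [cutoff, h, hr]

lemma setLIntegral_ge_of_antitone {φ : ℝ → ℝ≥0∞} (hφ : Antitone φ) (T : ℝ) :
    ENNReal.ofReal T * φ T ≤ ∫⁻ s in Iio T, φ s ∂halfLine :=
  calc ENNReal.ofReal T * φ T = ∫⁻ s in Iio T, φ T ∂halfLine := by simp [halfLine_Iio, mul_comm]
    _ ≤ _ := setLIntegral_mono' measurableSet_Iio fun s hs => hφ (le_of_lt hs)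

/-- The inner function $F(s)=\int_0^{\delta/s}\varphi$ is non-increasing, so
$\int_0^{\delta/t}F\ge(\delta/t)F(\delta/t)=(\delta/t)\int_0^t\varphi\ge\delta\varphi(t)$. It serves
both the norm equivalence and optimality. -/
lemma le_kernelOp_cutoff_kernelOp_cutoff {φ : ℝ → ℝ≥0∞} (hφ : Antitone φ) {δ t : ℝ} (hδ : 0 < δ)
    (ht : 0 < t) :
    ENNReal.ofReal δ * φ t ≤ kernelOp (cutoff δ) (kernelOp (cutoff δ) φ) t := by
  rw [kernelOp_cutoff ht]
  refine le_trans ?_ (setLIntegral_ge_of_antitone (kernelOp_antitone (cutoff_antitone δ) φ) _)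
  rw [kernelOp_cutoff (by positivity), div_div_cancel₀ hδ.ne']
  calc ENNReal.ofReal δ * φ t = ENNReal.ofReal (δ / t) * (ENNReal.ofReal t * φ t) := by
        rw [← mul_assoc, ← ENNReal.ofReal_mul (by positivity), div_mul_cancel₀ _ ht.ne']
    _ ≤ _ := by gcongr; exact setLIntegral_ge_of_antitone hφ t

/-- The rearrangement-invariant norm equivalent to the Lorentz functional. -/
noncomputable def lorentzNorm (θ : ℝ) (η : ℝ≥0∞) (f : ℝ → ℝ≥0∞) : ℝ≥0∞ :=
  powerNorm (1 - θ) η (kernelOp (cutoff 1) (rearrangement f))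

lemma lorentzNorm_le (θ : ℝ) {η : ℝ≥0∞} (hη : 1 ≤ η) (f : ℝ → ℝ≥0∞) :
    lorentzNorm θ η f ≤ (∫⁻ s, cutoff 1 s * ENNReal.ofReal (s ^ (-θ)) ∂halfLine) *
      powerNorm θ η (rearrangement f) :=
  powerNorm_kernelOp_le (cutoff_antitone 1) (measurable_rearrangement f) θ hη

lemma powerNorm_rearrangement_le (θ : ℝ) {η : ℝ≥0∞} (hη : 1 ≤ η) (f : ℝ → ℝ≥0∞) :
    powerNorm θ η (rearrangement f) ≤
      (∫⁻ s, cutoff 1 s * ENNReal.ofReal (s ^ (-(1 - θ))) ∂halfLine) * lorentzNorm θ η f := by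
  refine le_trans (powerNorm_mono ?_) (le_of_eq_of_le (by rw [sub_sub_cancel])
    (powerNorm_kernelOp_le (cutoff_antitone 1)
    (kernelOp_antitone (cutoff_antitone 1) (rearrangement f)).measurable (1 - θ) hη))
  filter_upwards [ae_halfLine_pos] with t ht
  simpa using le_kernelOp_cutoff_kernelOp_cutoff (rearrangement_antitone f) one_pos ht

lemma kernelOp_iSup {k : ℝ → ℝ≥0∞} (hk : Antitone k) {u : ℕ → ℝ → ℝ≥0∞}
    (hu : ∀ n, Measurable (u n)) (hmono : Monotone u) (t : ℝ) :
    kernelOp k (fun s => ⨆ n, u n s) t = ⨆ n, kernelOp k (u n) t := by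
  simp only [kernelOp, ENNReal.mul_iSup]
  refine lintegral_iSup (fun n => ?_) fun m n h s => ?_
  · have := hk.measurable
    have := hu n
    fun_prop
  · dsimp only
    gcongr
    exact hmono h s

/-- Under $t\mapsto1/t$ this is the usual norm $\|t^\theta f^{**}(t)\|_{L^\eta(dt/t)}$, with
$f^{**}(t)=\frac1t\int_0^tf^*$; the triangle inequality comes from subadditivity of $\int_0^Tf^*$.
-/
lemma isRINorm_lorentzNorm {θ : ℝ} (h0 : 0 < θ) (h1 : θ < 1) {η : ℝ≥0∞} (hη : 1 ≤ η) :
    IsRINorm (lorentzNorm θ η) := by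
  have hanti : ∀ f, Antitone (kernelOp (cutoff 1) (rearrangement f)) := fun f =>
    kernelOp_antitone (cutoff_antitone 1) _
  have hA : ∫⁻ s, cutoff 1 s * ENNReal.ofReal (s ^ (-θ)) ∂halfLine < ∞ :=
    lintegral_cutoff_mul_rpow_lt_top (by linarith) 1
  have hmono : ∀ f g : ℝ → ℝ≥0∞, (∀ᵐ s ∂halfLine, f s ≤ g s) →
      lorentzNorm θ η f ≤ lorentzNorm θ η g := by
    intro f g h
    refine powerNorm_mono (ae_of_all _ fun t => lintegral_mono fun s => ?_)
    gcongr
    exact rearrangement_mono_ae h s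
  refine ⟨?_, ?_, ?_, ?_, ?_, ?_, ?_, ?_⟩
  · intro f hf
    have hz : lorentzNorm θ η f = 0 ↔ powerNorm θ η (rearrangement f) = 0 := by
      constructor <;> intro h
      · simpa [h] using powerNorm_rearrangement_le θ hη f
      · simpa [h] using lorentzNorm_le θ hη f
    rw [hz, powerNorm_eq_zero_iff hη (measurable_rearrangement f),
      ← lintegral_eq_zero_iff (measurable_rearrangement f), lintegral_rearrangement hf,
      lintegral_eq_zero_iff' hf]
  · intro c f _
    rw [lorentzNorm, lorentzNorm, ← powerNorm_const_mul ENNReal.coe_ne_top hη]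
    congr 1
    funext t
    simp only [kernelOp, rearrangement_const_mul]
    rw [← lintegral_const_mul' _ _ ENNReal.coe_ne_top]
    simp only [mul_left_comm]
  · intro f g hf hg
    refine le_trans (powerNorm_mono ?_) (powerNorm_add_le hη (hanti f).measurable
      (hanti g).measurable)
    filter_upwards [ae_halfLine_pos] with t ht
    simp only [kernelOp_cutoff ht]
    exact setLIntegral_rearrangement_add_le hf hg _
  · exact fun f g _ _ => hmono f g
  · intro u f _ _ h
    have hum : ∀ᵐ s ∂halfLine, Monotone fun n => u n s := h.mono fun _ hs => hs.1
    have hrm : Monotone fun n => rearrangement (u n) := fun m n hmn t =>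
      rearrangement_mono_ae (hum.mono fun s hs => hs hmn) t
    have hf : rearrangement f = fun t => ⨆ n, rearrangement (u n) t :=
      funext (rearrangement_iSup h)
    have hk : kernelOp (cutoff 1) (rearrangement f) =
        fun t => ⨆ n, kernelOp (cutoff 1) (rearrangement (u n)) t := by
      funext t
      rw [hf, kernelOp_iSup (cutoff_antitone 1) (fun n => measurable_rearrangement _) hrm]
    rw [lorentzNorm, hk, powerNorm_iSup hη (fun n => (hanti _).measurable)]
    · rfl
    · intro m n hmn t
      refine lintegral_mono fun s => ?_
      gcongr
      exact hrm hmn s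
  · intro G hG hsub hvol
    have hle : ∀ t, rearrangement (G.indicator fun _ => 1) t ≤ cutoff (volume G).toReal t := by
      intro t
      by_cases ht : t < (volume G).toReal
      · simp only [cutoff, mem_Iio, ht, indicator_of_mem, Pi.one_apply]
        refine rearrangement_le_iff.2 (le_of_eq_of_le ?_ zero_le)
        have : {x | (1 : ℝ≥0∞) < G.indicator (fun _ => 1) x} = ∅ := by
          ext x
          by_cases hx : x ∈ G <;> simp [hx]
        rw [distribution, this, measure_empty]
      · simp only [cutoff, mem_Iio, ht, not_false_eq_true, indicator_of_notMem]
        refine rearrangement_le_iff.2 (le_trans (measure_mono (t := G) fun x hx => ?_) ?_)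
        · by_contra hxG
          simp [hxG] at hx
        · refine (Measure.restrict_apply_le _ _).trans ?_
          rw [← ENNReal.ofReal_toReal hvol.ne]
          exact ENNReal.ofReal_le_ofReal (not_lt.1 ht)
    refine (lorentzNorm_le θ hη _).trans_lt (ENNReal.mul_lt_top hA ?_)
    exact (powerNorm_mono (ae_of_all _ hle)).trans_lt (powerNorm_cutoff_lt_top h0 hη _)
  · intro G hG hsub hvol
    have hGh : halfLine G = volume G := by
      rw [halfLine, Measure.restrict_apply hG, inter_eq_left.2 hsub]
    have hGr : volume.restrict G = halfLine.restrict G := by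
      rw [halfLine, Measure.restrict_restrict hG, inter_eq_left.2 hsub]
    rcases eq_or_ne (volume G) 0 with hz | hz
    · exact ⟨0, fun f _ => by simp [setLIntegral_measure_zero _ _ hz]⟩
    have hT : 0 < (volume G).toReal := ENNReal.toReal_pos hz hvol.ne
    set T := (volume G).toReal
    -- For $t<1/T$ one has $\int_0^{1/t}f^*\ge\int_0^Tf^*$, so the norm is at least $c\int_0^Tf^*$.
    set c := powerNorm (1 - θ) η (cutoff T⁻¹)
    have hc_top : c ≠ ∞ := (powerNorm_cutoff_lt_top (by linarith) hη _).ne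
    have hc0 : c ≠ 0 := by
      rw [ne_eq, powerNorm_eq_zero_iff hη (cutoff_antitone _).measurable,
        ← lintegral_eq_zero_iff (cutoff_antitone _).measurable]
      simpa using (lintegral_cutoff_mul_rpow_pos (x := 0) (inv_pos.2 hT)).ne'
    refine ⟨c⁻¹.toNNReal, fun f hf => ?_⟩
    rw [ENNReal.coe_toNNReal (ENNReal.inv_ne_top.2 hc0), hGr]
    set I := ∫⁻ s in Iio T, rearrangement f s ∂halfLine
    have hI : ∫⁻ s in G, f s ∂halfLine ≤ I := by
      refine (setLIntegral_le_setLIntegral_rearrangement hf G).trans (lintegral_mono_set ?_)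
      intro s hs
      rw [mem_ofPred_eq, hGh, ← ENNReal.ofReal_toReal hvol.ne,
        ENNReal.ofReal_lt_ofReal_iff hT] at hs
      exact hs
    -- Finite $b\le I$ are used because $I$ may be infinite, while homogeneity is applied with
    -- finite constants.
    have hbound : ∀ b : ℝ≥0∞, b ≠ ∞ → b ≤ I → b ≤ c⁻¹ * lorentzNorm θ η f := by
      intro b hb hbI
      rw [mul_comm, ← div_eq_mul_inv, ENNReal.le_div_iff_mul_le (Or.inl hc0) (Or.inl hc_top),
        ← powerNorm_const_mul hb hη]
      refine powerNorm_mono ?_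
      filter_upwards [ae_halfLine_pos] with t ht
      rw [kernelOp_cutoff ht]
      by_cases h : t < T⁻¹
      · simp only [cutoff, mem_Iio, h, indicator_of_mem, Pi.one_apply, mul_one]
        refine hbI.trans (lintegral_mono_set (Iio_subset_Iio ?_))
        rw [one_div]
        exact (le_inv_comm₀ ht hT).1 h.le
      · simp [cutoff, h]
    refine hI.trans (ENNReal.le_of_forall_nnreal_lt fun r hr => ?_)
    exact hbound r ENNReal.coe_ne_top hr.le
  · intro f g _ _ h
    rw [lorentzNorm, lorentzNorm]
    congr 1
    funext t
    refine lintegral_congr_ae ?_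
    filter_upwards [ae_halfLine_pos] with s hs
    rw [h s hs]

lemma isRISpace_lorentz {p η : ℝ≥0∞} (hp : 1 ≤ p) (h0 : 0 < p⁻¹.toReal) (h1 : p⁻¹.toReal < 1)
    (hη : 1 ≤ η) : IsRISpace (lorentz p η) := by
  set θ := p⁻¹.toReal with hθ
  set A := ∫⁻ s, cutoff 1 s * ENNReal.ofReal (s ^ (-θ)) ∂halfLine
  set B := ∫⁻ s, cutoff 1 s * ENNReal.ofReal (s ^ (-(1 - θ))) ∂halfLine
  have hA : A ≠ ∞ := (lintegral_cutoff_mul_rpow_lt_top (by linarith) 1).ne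
  have hB : B ≠ ∞ := (lintegral_cutoff_mul_rpow_lt_top (by linarith) 1).ne
  refine ⟨lorentzNorm θ η, isRINorm_lorentzNorm h0 h1 hη, A.toNNReal + 2 * B.toNNReal + 1,
    by positivity, fun f _ => ⟨?_, ?_⟩⟩
  · calc lorentz p η f ≤ 2 * powerNorm θ η (rearrangement f) := lorentz_le_powerNorm hη hp f
      _ ≤ 2 * (B * lorentzNorm θ η f) := by
          gcongr
          exact powerNorm_rearrangement_le θ hη f
      _ ≤ _ := by
          push_cast
          rw [ENNReal.coe_toNNReal hA, ENNReal.coe_toNNReal hB, ← mul_assoc]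
          gcongr
          exact le_add_right le_add_self
  · calc lorentzNorm θ η f ≤ A * powerNorm θ η (rearrangement f) := lorentzNorm_le θ hη f
      _ ≤ A * lorentz p η f := by
          gcongr
          exact powerNorm_le_lorentz hη f
      _ ≤ _ := by
          push_cast
          rw [ENNReal.coe_toNNReal hA]
          gcongr
          rw [add_assoc]
          exact le_self_add

/-! ### Boundedness of $S_a$ on Lorentz spaces. -/

/-- The extension of a function on `(0,∞)` to `ℝ` by the value `∞`; it is non-increasing if the
function is. -/
noncomputable def extendTop (a : ℝ → ℝ) (t : ℝ) : ℝ≥0∞ :=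
  if 0 < t then ENNReal.ofReal (a t) else ∞

lemma extendTop_of_pos {a : ℝ → ℝ} {t : ℝ} (ht : 0 < t) : extendTop a t = ENNReal.ofReal (a t) :=
  if_pos ht

lemma extendTop_antitone {a : ℝ → ℝ} (ha : AntitoneOn a (Ioi 0)) : Antitone (extendTop a) := by
  intro s t h
  by_cases hs : 0 < s
  · rw [extendTop_of_pos hs, extendTop_of_pos (hs.trans_le h)]
    exact ENNReal.ofReal_le_ofReal (ha hs (hs.trans_le h) h)
  · simp [extendTop, hs]

lemma aemeasurable_opS {a f : ℝ → ℝ} (ha0 : ∀ t ∈ Ioi (0 : ℝ), 0 ≤ a t)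
    (ha : AntitoneOn a (Ioi 0)) (hf : AEMeasurable f halfLine) :
    AEMeasurable (opS a f) halfLine := by
  have hk := (extendTop_antitone ha).measurable
  have hm : Measurable fun p : ℝ × ℝ => (extendTop a (p.2 * p.1)).toReal * hf.mk f p.2 :=
    (hk.comp (measurable_snd.mul measurable_fst)).ennreal_toReal.mul
      (hf.measurable_mk.comp measurable_snd)
  have hS := (hm.stronglyMeasurable.integral_prod_right' (ν := halfLine)).measurable
  refine ⟨_, hS, ?_⟩
  filter_upwards [ae_halfLine_pos] with t ht
  refine integral_congr_ae ?_
  filter_upwards [ae_halfLine_pos, hf.ae_eq_mk] with s hs hfs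
  have hst : 0 < s * t := mul_pos hs ht
  rw [extendTop_of_pos hst, ENNReal.toReal_ofReal (ha0 _ hst), hfs]

lemma lintegral_enorm_kernel_le {a f : ℝ → ℝ} (ha0 : ∀ t ∈ Ioi (0 : ℝ), 0 ≤ a t)
    (ha : AntitoneOn a (Ioi 0)) (hf : AEMeasurable f halfLine) {t : ℝ} (ht : 0 < t) :
    ∫⁻ s, ‖a (s * t) * f s‖ₑ ∂halfLine ≤
      kernelOp (extendTop a) (rearrangement fun s => ‖f s‖ₑ) t := by
  have hk : Antitone fun s => extendTop a (s * t) := fun s s' h =>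
    extendTop_antitone ha (by gcongr)
  refine le_trans (le_of_eq ?_) (lintegral_antitone_mul_le hk hf.enorm)
  refine lintegral_congr_ae ?_
  filter_upwards [ae_halfLine_pos] with s hs
  have hst : 0 < s * t := mul_pos hs ht
  rw [enorm_mul, extendTop_of_pos hst, Real.enorm_of_nonneg (ha0 _ hst)]

lemma aestronglyMeasurable_kernel_mul {a f : ℝ → ℝ} (ha : AntitoneOn a (Ioi 0))
    (hf : AEMeasurable f halfLine) {t : ℝ} (ht : 0 < t) :
    AEStronglyMeasurable (fun s => a (s * t) * f s) halfLine := by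
  have h : AntitoneOn (fun s => a (s * t)) (Ioi 0) := fun s hs s' hs' h =>
    ha (mul_pos hs ht) (mul_pos hs' ht) (by gcongr)
  exact ((aemeasurable_restrict_of_antitoneOn measurableSet_Ioi h).mul hf).aestronglyMeasurable

/-- The majorant $G=S_af^*$ is controlled by Schur's test. Its finiteness almost everywhere gives
absolute convergence, and its monotonicity passes the bound to $(S_af)^*$. -/
lemma mapsBoundedly_lorentz {a : ℝ → ℝ} (ha0 : ∀ t ∈ Ioi (0 : ℝ), 0 ≤ a t)
    (ha : AntitoneOn a (Ioi 0)) {p q η : ℝ≥0∞} (hη : 1 ≤ η) (hq : 1 ≤ q)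
    (hpq : q⁻¹.toReal = 1 - p⁻¹.toReal)
    (hint : ∫⁻ u, ENNReal.ofReal (a u) * ENNReal.ofReal (u ^ (-p⁻¹.toReal)) ∂halfLine < ∞) :
    MapsBoundedly a (lorentz p η) (lorentz q η) := by
  set A := ∫⁻ u, ENNReal.ofReal (a u) * ENNReal.ofReal (u ^ (-p⁻¹.toReal)) ∂halfLine with hA
  have hA' : ∫⁻ u, extendTop a u * ENNReal.ofReal (u ^ (-p⁻¹.toReal)) ∂halfLine = A := by
    refine lintegral_congr_ae ?_
    filter_upwards [ae_halfLine_pos] with u hu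
    rw [extendTop_of_pos hu]
  refine ⟨2 * A.toNNReal, fun f ⟨hf, hfin⟩ => ?_⟩
  set G := kernelOp (extendTop a) (rearrangement fun s => ‖f s‖ₑ)
  have hG : Antitone G := kernelOp_antitone (extendTop_antitone ha) _
  have hGle : powerNorm q⁻¹.toReal η G ≤ A * lorentz p η fun s => ‖f s‖ₑ := by
    rw [hpq, ← hA']
    refine (powerNorm_kernelOp_le (extendTop_antitone ha) (measurable_rearrangement _)
      p⁻¹.toReal hη).trans ?_
    gcongr
    exact powerNorm_le_lorentz hη _
  have hGfin := ae_lt_top_of_powerNorm_lt_top hη hG.measurable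
    (hGle.trans_lt (ENNReal.mul_lt_top hint hfin))
  have hSle : ∀ᵐ t ∂halfLine, ‖opS a f t‖ₑ ≤ G t := by
    filter_upwards [ae_halfLine_pos] with t ht
    exact (enorm_integral_le_lintegral_enorm _).trans (lintegral_enorm_kernel_le ha0 ha hf ht)
  have hbound : lorentz q η (fun t => ‖opS a f t‖ₑ) ≤
      (2 * A.toNNReal : ℝ≥0) * lorentz p η fun s => ‖f s‖ₑ := by
    calc lorentz q η (fun t => ‖opS a f t‖ₑ)
        ≤ 2 * powerNorm q⁻¹.toReal η (rearrangement fun t => ‖opS a f t‖ₑ) :=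
          lorentz_le_powerNorm hη hq _
      _ ≤ 2 * powerNorm q⁻¹.toReal η G := by
          gcongr
          exact powerNorm_mono (ae_of_all _ (rearrangement_le_of_le_antitone hG hSle))
      _ ≤ 2 * (A * lorentz p η fun s => ‖f s‖ₑ) := by gcongr
      _ = _ := by
          push_cast
          rw [ENNReal.coe_toNNReal hint.ne, mul_assoc]
  refine ⟨?_, ⟨aemeasurable_opS ha0 ha hf, ?_⟩, hbound⟩
  · filter_upwards [ae_halfLine_pos, hGfin] with t ht hfin
    exact ⟨aestronglyMeasurable_kernel_mul ha hf ht,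
      (lintegral_enorm_kernel_le ha0 ha hf ht).trans_lt hfin⟩
  · exact hbound.trans_lt (ENNReal.mul_lt_top ENNReal.coe_lt_top hfin)

/-! ### Optimality of the range. -/

/-- Any rearrangement-invariant space into which `S_a` maps `L^{p,η}` contains the Lorentz space
with the conjugate first exponent. -/
lemma embeds_of_mapsBoundedly {a : ℝ → ℝ} (ha0 : ∀ t ∈ Ioi (0 : ℝ), 0 ≤ a t)
    (ha : AntitoneOn a (Ioi 0)) (ha_nontrivial : ¬ a =ᵐ[halfLine] 0) {p q η : ℝ≥0∞} (hη : 1 ≤ η)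
    (hp : 1 ≤ p) (hp0 : 0 < p⁻¹.toReal) (hpq : q⁻¹.toReal = 1 - p⁻¹.toReal)
    {τ : (ℝ → ℝ≥0∞) → ℝ≥0∞} (hτ : IsRINorm τ) (h : MapsBoundedly a (lorentz p η) τ) :
    Embeds (lorentz q η) τ := by
  obtain ⟨δ, hδ, haδ⟩ : ∃ δ, 0 < δ ∧ 0 < a δ := by
    by_contra! hcon
    exact ha_nontrivial (ae_halfLine_pos.mono fun t ht => le_antisymm (hcon t ht) (ha0 t ht))
  obtain ⟨C, hC⟩ := h
  set A := ∫⁻ s, cutoff δ s * ENNReal.ofReal (s ^ (-q⁻¹.toReal)) ∂halfLine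
  have hA : A < ∞ := lintegral_cutoff_mul_rpow_lt_top (by linarith) δ
  set c : ℝ≥0 := Real.toNNReal (a δ) * Real.toNNReal δ
  have hc : (c : ℝ≥0∞) = ENNReal.ofReal (a δ) * ENNReal.ofReal δ := ENNReal.coe_mul _ _
  have hc0 : c ≠ 0 := by simp [c, hδ, haδ]
  refine ⟨c⁻¹ * (C * (2 * A.toNNReal)), fun g ⟨hg, hgfin⟩ => ?_⟩
  set φ := rearrangement fun s => ‖g s‖ₑ with hφ
  -- The test function: $S_a$ applied to it recovers $\varphi=g^*$ up to the constant $c=\delta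
  -- a(\delta)$.
  set F := kernelOp (cutoff δ) φ
  have hF : Antitone F := kernelOp_antitone (cutoff_antitone δ) φ
  have hFle : powerNorm p⁻¹.toReal η F ≤ A * lorentz q η fun s => ‖g s‖ₑ := by
    have h1 : p⁻¹.toReal = 1 - q⁻¹.toReal := by rw [hpq, sub_sub_cancel]
    rw [h1]
    refine (powerNorm_kernelOp_le (cutoff_antitone δ) (measurable_rearrangement _) _ hη).trans ?_
    gcongr
    exact powerNorm_le_lorentz hη _
  have hFfin := ae_lt_top_of_powerNorm_lt_top hη hF.measurable
    (hFle.trans_lt (ENNReal.mul_lt_top hA hgfin))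
  set f : ℝ → ℝ := fun s => (F s).toReal
  have hfF : ∀ᵐ s ∂halfLine, ‖f s‖ₑ = F s := by
    filter_upwards [hFfin] with s hs
    rw [Real.enorm_of_nonneg ENNReal.toReal_nonneg, ENNReal.ofReal_toReal hs.ne]
  have hfle : lorentz p η (fun s => ‖f s‖ₑ) ≤ 2 * (A * lorentz q η fun s => ‖g s‖ₑ) := by
    refine (lorentz_le_powerNorm hη hp _).trans ?_
    gcongr
    refine (powerNorm_mono (ae_of_all _ ?_)).trans hFle
    exact rearrangement_le_of_le_antitone hF (hfF.mono fun s hs => hs.le)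
  have hfmem : Mem (lorentz p η) f := ⟨hF.measurable.ennreal_toReal.aemeasurable,
    hfle.trans_lt (ENNReal.mul_lt_top (by simp) (ENNReal.mul_lt_top hA hgfin))⟩
  obtain ⟨hconv, ⟨hSm, hSfin⟩, hSle⟩ := hC f hfmem
  have hlower : ∀ᵐ t ∂halfLine, (c : ℝ≥0∞) * φ t ≤ ‖opS a f t‖ₑ := by
    filter_upwards [hconv, ae_halfLine_pos] with t hI ht
    have hnn : ∀ᵐ s ∂halfLine, 0 ≤ a (s * t) * f s := by
      filter_upwards [ae_halfLine_pos] with s hs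
      exact mul_nonneg (ha0 _ (mul_pos hs ht)) ENNReal.toReal_nonneg
    rw [opS, Real.enorm_of_nonneg (integral_nonneg_of_ae hnn),
      ofReal_integral_eq_lintegral_ofReal hI hnn, hc, mul_assoc]
    refine (mul_le_mul_right (le_kernelOp_cutoff_kernelOp_cutoff
      (rearrangement_antitone _) hδ ht) _).trans ?_
    rw [kernelOp, ← lintegral_const_mul' _ _ ENNReal.ofReal_ne_top]
    refine lintegral_mono_ae ?_
    filter_upwards [ae_halfLine_pos, hFfin] with s hs hfin
    have hst : 0 < s * t := mul_pos hs ht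
    rw [ENNReal.ofReal_mul (ha0 _ hst), ENNReal.ofReal_toReal hfin.ne]
    by_cases hlt : s * t < δ
    · simp only [cutoff, mem_Iio, hlt, indicator_of_mem, Pi.one_apply, one_mul]
      -- Here $a\ge a(\delta)$ on $(0,\delta)$.
      exact mul_le_mul' (ENNReal.ofReal_le_ofReal (ha hst hδ hlt.le)) le_rfl
    · simp [cutoff, hlt]
  have hφm : AEMeasurable φ halfLine := (measurable_rearrangement _).aemeasurable
  have hτg : τ (fun s => ‖g s‖ₑ) = τ φ :=
    hτ.rearrangement_congr _ _ hg.enorm hφm fun t _ => by rw [hφ, rearrangement_rearrangement]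
  have hτφ : c * τ φ ≤ τ fun t => ‖opS a f t‖ₑ := by
    rw [← hτ.smul c φ hφm]
    exact hτ.mono _ _ (hφm.const_mul _) hSm.enorm hlower
  have hbound : τ (fun s => ‖g s‖ₑ) ≤
      (c⁻¹ * (C * (2 * A.toNNReal)) : ℝ≥0) * lorentz q η fun s => ‖g s‖ₑ := by
    have hc0' : (c : ℝ≥0∞) ≠ 0 := by simpa using hc0
    calc τ (fun s => ‖g s‖ₑ) = (c : ℝ≥0∞)⁻¹ * (c * τ φ) := by
          rw [← mul_assoc, ENNReal.inv_mul_cancel hc0' ENNReal.coe_ne_top, one_mul, hτg]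
      _ ≤ (c : ℝ≥0∞)⁻¹ * (C * (2 * (A * lorentz q η fun s => ‖g s‖ₑ))) := by
          exact mul_le_mul' le_rfl (hτφ.trans (hSle.trans (mul_le_mul' le_rfl hfle)))
      _ = _ := by
          push_cast
          rw [ENNReal.coe_inv hc0, ENNReal.coe_toNNReal hA.ne]
          ring
  exact ⟨⟨hg, hbound.trans_lt (ENNReal.mul_lt_top ENNReal.coe_lt_top hgfin)⟩, hbound⟩

lemma isOptimalRangePartner_lorentz {a : ℝ → ℝ} (ha0 : ∀ t ∈ Ioi (0 : ℝ), 0 ≤ a t)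
    (ha : AntitoneOn a (Ioi 0)) (ha_nontrivial : ¬ a =ᵐ[halfLine] 0) {p q η : ℝ≥0∞} (hη : 1 ≤ η)
    (hp : 1 ≤ p) (hq : 1 ≤ q) (hp0 : 0 < p⁻¹.toReal) (hp1 : p⁻¹.toReal < 1)
    (hpq : q⁻¹.toReal = 1 - p⁻¹.toReal)
    (hint : ∫⁻ u, ENNReal.ofReal (a u) * ENNReal.ofReal (u ^ (-p⁻¹.toReal)) ∂halfLine < ∞) :
    IsOptimalRangePartner a (lorentz p η) (lorentz q η) :=
  ⟨isRISpace_lorentz hp hp0 hp1 hη,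
    isRISpace_lorentz hq (by rw [hpq]; linarith) (by rw [hpq]; linarith) hη,
    mapsBoundedly_lorentz ha0 ha hη hq hpq hint,
    fun _ hτ h => embeds_of_mapsBoundedly ha0 ha ha_nontrivial hη hp hp0 hpq hτ h⟩

/-! ### Power bounds for the kernel and finiteness of its moment. -/

/-- A non-increasing function dominated by powers on either side of the critical exponent has a
finite moment. -/
lemma lintegral_mul_rpow_lt_top_of_le {a : ℝ → ℝ} {α β θ K L : ℝ} (hα : α + θ < 1)
    (hβ : 1 < β + θ) (h0 : ∀ t, 0 < t → t < 1 → a t ≤ K * t ^ (-α))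
    (h1 : ∀ t, 1 ≤ t → a t ≤ L * t ^ (-β)) :
    ∫⁻ u, ENNReal.ofReal (a u) * ENNReal.ofReal (u ^ (-θ)) ∂halfLine < ∞ := by
  have hle : ∀ {t x M : ℝ}, 0 < t → a t ≤ M * t ^ (-x) →
      ENNReal.ofReal (a t) * ENNReal.ofReal (t ^ (-θ)) ≤
        ENNReal.ofReal M * ENNReal.ofReal (t ^ (-(x + θ))) := by
    intro t x M ht h
    rw [neg_add, Real.rpow_add ht, ENNReal.ofReal_mul (p := t ^ (-x)) (by positivity),
      ← mul_assoc, ← ENNReal.ofReal_mul' (p := M) (by positivity)]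
    exact mul_le_mul' (ENNReal.ofReal_le_ofReal h) le_rfl
  rw [halfLine, ← Ioo_union_Ici_eq_Ioi zero_lt_one]
  refine (lintegral_union_le _ _ _).trans_lt (ENNReal.add_lt_top.2 ⟨?_, ?_⟩)
  · refine (setLIntegral_mono' measurableSet_Ioo fun t ht => hle ht.1 (h0 t ht.1 ht.2)).trans_lt ?_
    rw [lintegral_const_mul' _ _ ENNReal.ofReal_ne_top]
    refine ENNReal.mul_lt_top ENNReal.ofReal_lt_top ?_
    exact (lintegral_mono fun s => Real.ofReal_le_enorm _).trans_lt
      ((intervalIntegral.integrableOn_Ioo_rpow_iff zero_lt_one).2 (by linarith)).hasFiniteIntegral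
  · refine (setLIntegral_mono' measurableSet_Ici fun t (ht : 1 ≤ t) =>
      hle (zero_lt_one.trans_le ht) (h1 t ht)).trans_lt ?_
    rw [lintegral_const_mul' _ _ ENNReal.ofReal_ne_top, setLIntegral_congr Ioi_ae_eq_Ici.symm]
    refine ENNReal.mul_lt_top ENNReal.ofReal_lt_top ?_
    exact (lintegral_mono fun s => Real.ofReal_le_enorm _).trans_lt
      (integrableOn_Ioi_rpow_of_lt (by linarith) zero_lt_one).hasFiniteIntegral

/-- A non-increasing member of a weak Lorentz space is dominated by a power. -/
lemma exists_le_mul_rpow_of_mem_lorentz_top {b : ℝ → ℝ} (hb0 : ∀ t ∈ Ioi (0 : ℝ), 0 ≤ b t)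
    (hb : AntitoneOn b (Ioi 0)) {r : ℝ≥0∞} (h : Mem (lorentz r ∞) b) :
    ∃ K : ℝ, 0 ≤ K ∧ ∀ t, 0 < t → b t ≤ K * t ^ (-r⁻¹.toReal) := by
  set M := lorentz r ∞ fun s => ‖b s‖ₑ with hM
  have hMtop : M < ∞ := h.2
  set x := r⁻¹.toReal
  refine ⟨M.toReal * 2 ^ x, by positivity, fun t ht => ?_⟩
  -- The set $\{b>l\}$ contains $(0,t)$ when $l<b(t)$; halving $t$ makes the needed measure
  -- inequality strict, at the cost of the factor $2^x$.
  have ht2 : 0 < t / 2 := by linarith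
  have hr : ENNReal.ofReal (b t) ≤ rearrangement (fun s => ‖b s‖ₑ) (t / 2) := by
    refine le_of_forall_lt fun l hl => lt_rearrangement_iff.2 ?_
    have hsub : Ioo 0 t ⊆ {s | l < ‖b s‖ₑ} := by
      intro s hs
      rw [mem_ofPred_eq, Real.enorm_of_nonneg (hb0 s hs.1)]
      exact hl.trans_le (ENNReal.ofReal_le_ofReal (hb hs.1 ht hs.2.le))
    refine lt_of_lt_of_le ?_ (measure_mono hsub)
    rw [halfLine, Measure.restrict_apply measurableSet_Ioo, inter_eq_left.2 Ioo_subset_Ioi_self,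
      Real.volume_Ioo, sub_zero]
    exact (ENNReal.ofReal_lt_ofReal_iff ht).2 (by linarith)
  have h2 : ENNReal.ofReal ((t / 2) ^ x) * rearrangement (fun s => ‖b s‖ₑ) (t / 2) ≤ M := by
    rw [hM, lorentz, if_pos rfl]
    exact le_iSup₂ (f := fun t (_ : t ∈ Ioi (0 : ℝ)) =>
      ENNReal.ofReal (t ^ x) * rearrangement (fun s => ‖b s‖ₑ) t) (t / 2) ht2
  have h3 : (t / 2) ^ x * b t ≤ M.toReal := by
    rw [← ENNReal.ofReal_le_iff_le_toReal hMtop.ne, ENNReal.ofReal_mul (by positivity)]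
    exact (by gcongr : _ ≤ _).trans h2
  have h4 : b t ≤ M.toReal / (t / 2) ^ x := by
    rwa [le_div_iff₀ (by positivity), mul_comm]
  refine h4.trans (le_of_eq ?_)
  rw [Real.div_rpow ht.le (by norm_num), Real.rpow_neg ht.le]
  field_simp

/-- By monotonicity, $t\,a(t)\le\int_0^ta\le\|a\|_1$. -/
lemma exists_le_mul_inv_of_memLp_one {a : ℝ → ℝ} (ha0 : ∀ t ∈ Ioi (0 : ℝ), 0 ≤ a t)
    (ha : AntitoneOn a (Ioi 0)) (h : MemLp a 1 halfLine) :
    ∃ K : ℝ, ∀ t, 0 < t → a t ≤ K * t ^ (-1 : ℝ) := by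
  have hI : ∫⁻ s, ‖a s‖ₑ ∂halfLine < ∞ := (memLp_one_iff_integrable.1 h).hasFiniteIntegral
  refine ⟨(∫⁻ s, ‖a s‖ₑ ∂halfLine).toReal, fun t ht => ?_⟩
  rw [Real.rpow_neg_one, ← div_eq_mul_inv, le_div_iff₀ ht,
    ← ENNReal.ofReal_le_iff_le_toReal hI.ne, mul_comm, ENNReal.ofReal_mul ht.le,
    ← extendTop_of_pos ht]
  refine (setLIntegral_ge_of_antitone (extendTop_antitone ha) t).trans ?_
  refine (lintegral_mono' Measure.restrict_le_self le_rfl).trans (lintegral_mono_ae ?_)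
  filter_upwards [ae_halfLine_pos] with s hs
  rw [extendTop_of_pos hs, Real.enorm_of_nonneg (ha0 s hs)]

lemma exists_le_of_memLp_top {a : ℝ → ℝ} (ha : AntitoneOn a (Ioi 0)) (h : MemLp a ∞ halfLine) :
    ∃ K : ℝ, ∀ t, 0 < t → a t ≤ K := by
  refine ⟨(eLpNorm a ∞ halfLine).toReal, fun t ht => ?_⟩
  have hae := enorm_ae_le_eLpNormEssSup a halfLine
  rw [halfLine, ae_restrict_iff' measurableSet_Ioi] at hae
  obtain ⟨s, hs, hs'⟩ := Measure.exists_mem_of_measure_ne_zero_of_ae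
    (by simpa using ht : volume (Ioo 0 t) ≠ 0) (ae_restrict_of_ae (s := Ioo 0 t) hae)
  refine (ha hs.1 ht hs.2.le).trans ?_
  rw [← ENNReal.ofReal_le_iff_le_toReal h.2.ne, eLpNorm_exponent_top]
  exact (Real.ofReal_le_enorm _).trans (hs' hs.1)

/-! ### Conjugate exponents, the part $a_1$, and the theorem. -/

lemma inv_toReal_conjExponent {p : ℝ≥0∞} (hp : 1 ≤ p) :
    p.conjExponent⁻¹.toReal = 1 - p⁻¹.toReal := by
  have h := (ENNReal.HolderConjugate.conjExponent hp).inv_add_inv_eq_one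
  have h1 : p⁻¹ ≠ ∞ := fun h' => by simp [h'] at h
  have h2 : p.conjExponent⁻¹ ≠ ∞ := fun h' => by simp [h'] at h
  rw [eq_sub_iff_add_eq, add_comm, ← ENNReal.toReal_add h1 h2, h, ENNReal.toReal_one]

lemma inv_toReal_lt_inv_toReal {p q : ℝ≥0∞} (hp : p ≠ 0) (h : p < q) :
    q⁻¹.toReal < p⁻¹.toReal :=
  (ENNReal.toReal_lt_toReal (ENNReal.inv_lt_top.2 (hp.bot_lt.trans h)).ne
    (ENNReal.inv_ne_top.2 hp)).2 (ENNReal.inv_lt_inv.2 h)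

lemma one_le_conjExponent (p : ℝ≥0∞) : 1 ≤ p.conjExponent := le_self_add

lemma partOne_nonneg {a : ℝ → ℝ} (ha : AntitoneOn a (Ioi 0)) (t : ℝ) : 0 ≤ partOne a t := by
  refine indicator_nonneg (fun s hs => sub_nonneg.2 ?_) t
  exact ha hs.1 (mem_Ioi.2 one_pos) hs.2.le

lemma partOne_antitoneOn {a : ℝ → ℝ} (ha : AntitoneOn a (Ioi 0)) :
    AntitoneOn (partOne a) (Ioi 0) := by
  intro s hs t ht h
  by_cases ht1 : t < 1
  · have hs' : s ∈ Ioo (0 : ℝ) 1 := ⟨hs, h.trans_lt ht1⟩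
    have ht' : t ∈ Ioo (0 : ℝ) 1 := ⟨ht, ht1⟩
    rw [partOne, indicator_of_mem ht', indicator_of_mem hs']
    exact sub_le_sub_right (ha hs ht h) _
  · rw [show partOne a t = 0 from indicator_of_notMem (fun h' => ht1 h'.2) _]
    exact partOne_nonneg ha s

end RISpace

theorem theoremT
    (a : ℝ → ℝ)
    (ha_nonneg : ∀ t ∈ Set.Ioi (0 : ℝ), 0 ≤ a t)
    (ha_anti : AntitoneOn a (Set.Ioi 0))
    (ha_nontrivial : ¬ (a =ᵐ[RISpace.halfLine] 0))
    (ξ η : ℝ≥0∞) (hη : η ∈ Set.Icc 1 ∞) :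
    -- general kernels `a = a_1 + a_∞` in `L^1 + L^∞`
    (∀ p q : ℝ≥0∞, p ∈ Set.Ico 1 ∞ → q ∈ Set.Ioc 1 ∞ → ξ ∈ Set.Ioo p q →
      RISpace.MemL1AddLinfty a →
      RISpace.Mem (RISpace.lorentz p.conjExponent ∞) (RISpace.partOne a) →
      RISpace.Mem (RISpace.lorentz q.conjExponent ∞) (RISpace.partInfty a) →
      RISpace.MapsBoundedly a (RISpace.lorentz ξ η) (RISpace.lorentz ξ.conjExponent η) ∧
      RISpace.IsOptimalRangePartner a (RISpace.lorentz ξ η)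
        (RISpace.lorentz ξ.conjExponent η)) ∧
    -- integrable kernels
    (∀ p : ℝ≥0∞, p ∈ Set.Ico 1 ∞ → ξ ∈ Set.Ioo 1 ∞ → p < ξ →
      MemLp a 1 RISpace.halfLine →
      RISpace.Mem (RISpace.lorentz p.conjExponent ∞) a →
      RISpace.MapsBoundedly a (RISpace.lorentz ξ η) (RISpace.lorentz ξ.conjExponent η) ∧
      RISpace.IsOptimalRangePartner a (RISpace.lorentz ξ η)
        (RISpace.lorentz ξ.conjExponent η)) ∧
    -- bounded kernels
    (∀ q : ℝ≥0∞, q ∈ Set.Ioc 1 ∞ → ξ ∈ Set.Ioo 1 ∞ → ξ < q →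
      MemLp a ∞ RISpace.halfLine →
      RISpace.Mem (RISpace.lorentz q.conjExponent ∞) a →
      RISpace.MapsBoundedly a (RISpace.lorentz ξ η) (RISpace.lorentz ξ.conjExponent η) ∧
      RISpace.IsOptimalRangePartner a (RISpace.lorentz ξ η)
        (RISpace.lorentz ξ.conjExponent η)) := by
  have key : ξ ∈ Set.Ioo 1 ∞ →
      ∫⁻ u, ENNReal.ofReal (a u) * ENNReal.ofReal (u ^ (-ξ⁻¹.toReal)) ∂(RISpace.halfLine) < ∞ →
      RISpace.MapsBoundedly a (RISpace.lorentz ξ η) (RISpace.lorentz ξ.conjExponent η) ∧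
      RISpace.IsOptimalRangePartner a (RISpace.lorentz ξ η)
        (RISpace.lorentz ξ.conjExponent η) := by
    intro hξ hint
    have h := RISpace.isOptimalRangePartner_lorentz ha_nonneg ha_anti ha_nontrivial hη.1 hξ.1.le
      (RISpace.one_le_conjExponent ξ)
      (ENNReal.toReal_pos (ENNReal.inv_ne_zero.2 hξ.2.ne)
        (ENNReal.inv_ne_top.2 (zero_lt_one.trans hξ.1).ne'))
      (by simpa using RISpace.inv_toReal_lt_inv_toReal one_ne_zero hξ.1)
      (RISpace.inv_toReal_conjExponent hξ.1.le) hint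
    exact ⟨h.2.2.1, h⟩
  refine ⟨fun p q hp hq hξ _ h1 h2 => ?_, fun p hp hξ hpξ h1 h2 => ?_, fun q hq hξ hξq h1 h2 => ?_⟩
  · obtain ⟨K, -, hK⟩ := RISpace.exists_le_mul_rpow_of_mem_lorentz_top
      (fun t _ => RISpace.partOne_nonneg ha_anti t) (RISpace.partOne_antitoneOn ha_anti) h1
    obtain ⟨L, -, hL⟩ := RISpace.exists_le_mul_rpow_of_mem_lorentz_top
      (b := RISpace.partInfty a)
      (fun t ht => le_min (ha_nonneg 1 (Set.mem_Ioi.2 one_pos)) (ha_nonneg t ht))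
      (fun s hs t ht h => min_le_min le_rfl (ha_anti hs ht h)) h2
    rw [RISpace.inv_toReal_conjExponent hp.1] at hK
    rw [RISpace.inv_toReal_conjExponent hq.1.le] at hL
    have hp0 : p ≠ 0 := (zero_lt_one.trans_le hp.1).ne'
    have hξ0 : ξ ≠ 0 := (hp0.bot_lt.trans hξ.1).ne'
    have hpξ := RISpace.inv_toReal_lt_inv_toReal hp0 hξ.1
    have hξq := RISpace.inv_toReal_lt_inv_toReal hξ0 hξ.2
    have hp1 : p⁻¹.toReal ≤ 1 := by
      simpa using ENNReal.toReal_mono ENNReal.one_ne_top (ENNReal.inv_le_one.2 hp.1)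
    refine key ⟨hp.1.trans_lt hξ.1, hξ.2.trans_le hq.2⟩
      -- The exponents are $1/p'$ and $1/q'$; the two conditions say $1/q<1/\xi<1/p$. On $(0,1)$,
      -- $a=a_1+a(1)$ and $a(1)\le a(1)t^{-1/p'}$, whence the constant $K+a(1)$.
      (RISpace.lintegral_mul_rpow_lt_top_of_le (α := 1 - p⁻¹.toReal) (β := 1 - q⁻¹.toReal)
        (K := K + a 1) (L := L) (by linarith) (by linarith) (fun t ht ht1 => ?_) fun t ht => ?_)
    · have h3 := hK t ht
      have ht' : t ∈ Set.Ioo (0 : ℝ) 1 := ⟨ht, ht1⟩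
      rw [RISpace.partOne, Set.indicator_of_mem ht'] at h3
      have h4 : 1 ≤ t ^ (-(1 - p⁻¹.toReal)) :=
        Real.one_le_rpow_of_pos_of_le_one_of_nonpos ht ht1.le (by linarith)
      nlinarith [ha_nonneg 1 (Set.mem_Ioi.2 one_pos)]
    · have ht0 : 0 < t := zero_lt_one.trans_le ht
      have h3 := hL t ht0
      rwa [RISpace.partInfty, min_eq_right (ha_anti (Set.mem_Ioi.2 one_pos) ht0 ht)] at h3
  · obtain ⟨K, -, hK⟩ := RISpace.exists_le_mul_rpow_of_mem_lorentz_top ha_nonneg ha_anti h2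
    obtain ⟨L, hL⟩ := RISpace.exists_le_mul_inv_of_memLp_one ha_nonneg ha_anti h1
    rw [RISpace.inv_toReal_conjExponent hp.1] at hK
    have hpξ' := RISpace.inv_toReal_lt_inv_toReal (zero_lt_one.trans_le hp.1).ne' hpξ
    have hξ0 : 0 < ξ⁻¹.toReal := ENNReal.toReal_pos (ENNReal.inv_ne_zero.2 hξ.2.ne)
      (ENNReal.inv_ne_top.2 (zero_lt_one.trans hξ.1).ne')
    -- Integrability supplies decay $t^{-1}$, enough at infinity because $\xi<\infty$.
    exact key hξ (RISpace.lintegral_mul_rpow_lt_top_of_le (β := 1) (by linarith) (by linarith)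
      (fun t ht _ => hK t ht) fun t ht => hL t (zero_lt_one.trans_le ht))
  · obtain ⟨K, hK⟩ := RISpace.exists_le_of_memLp_top ha_anti h1
    obtain ⟨L, -, hL⟩ := RISpace.exists_le_mul_rpow_of_mem_lorentz_top ha_nonneg ha_anti h2
    rw [RISpace.inv_toReal_conjExponent hq.1.le] at hL
    have hξq' := RISpace.inv_toReal_lt_inv_toReal (zero_lt_one.trans hξ.1).ne' hξq
    have hξ1 : ξ⁻¹.toReal < 1 := by
      simpa using RISpace.inv_toReal_lt_inv_toReal one_ne_zero hξ.1
    -- Boundedness supplies exponent $0$ near the origin, enough because $\xi>1$.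
    exact key hξ (RISpace.lintegral_mul_rpow_lt_top_of_le (α := 0) (K := K) (by linarith)
      (by linarith) (fun t ht _ => by simpa using hK t ht)
      fun t ht => hL t (zero_lt_one.trans_le ht))
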